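/- Let $p$ be a prime, $N\ge 1$ an integer prime to $p$, $K$ a normed field extension of $\mathbb{Q}_p$ containing a primitive $N$-th root of unity (for instance $K=\mathrm{Frac}(W(\mathbb{F}_q))$ with $N\mid q-1$), $A$ a complete commutative $K$-algebra with an ultrametric (submultiplicative) norm, and $\alpha\ge 1$. **Series.** Let $e_Z=\{e_0\}\cup\{e_z : z\in\mu_N(K)\}$. The weight of a word on $e_Z$ is its number of letters, its depth is its number of letters $\neq e_0$. Let $A\langle\langle e_Z\rangle\rangle$ be the algebra of non-commutative power series $f=\sum_w f[w]w$, and $A\langle\langle e_Z\rangle\rangle^{DR-RT}_{har}$ its subspace of the $f$ with $f[e_0^lw]=f[w]$ for all words $w$ and all $l\geq 0$. Let $\tilde\Pi(A)$ be the set of the $g\in A\langle\langle e_Z\rangle\rangle$ with constant term $1$ which satisfy the shuffle equation and $g[e_0]=g[e_1]=0$; let $\tilde\Pi(A)_\Sigma$ be the set of the $g\in\tilde\Pi(A)$ such that for each $d\ge1$ the coefficients $g[w]$, $w$ of depth $d$, tend to $0$ when the weight of $w$ tends to infinity; let $\tilde\Pi(A)_\Sigma^\dagger\subset\tilde\Pi(A)_\Sigma$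 be the set of those for which, for each $d\ge 1$, there is $r>1$ such that $|g[w]|\,r^{\mathrm{weight}(w)}\to0$, $w$ of depth $d$. For a set $S$ of invertible series let $\mathrm{Ad}_{S}(e_1)=\{g^{-1}e_1g : g\in S\}$. **Action.** For $x=g^{-1}e_1g$, $g \in \tilde\Pi(A)_\Sigma$, let $x_n=n^{-1}\sum_w n^{\mathrm{weight}(w)}x[w]\,w$, i.e. $x_n[w]=n^{\mathrm{weight}(w)-1}x[w]$ for $w \neq \emptyset$ (with $0^0=1$) and $x_n[\emptyset]=0$; let $x_n^{(z)}$ be the image of $x_n$ by $e_0\mapsto e_0$, $e_{z'}\mapsto e_{zz'}$. For a sequence $h=(h_n)_{n\in\mathbb{N}}$ in $A\langle\langle e_Z\rangle\rangle^{DR-RT}_{har}$, the harmonic Ihara action is $$(x\circ^{DR-RT}_{har}h)_n[w]=\lim_{l\to\infty}\big(h_n(e_0,(x_n^{(z)})_{z\in\mu_N(K)})\big)[e_0^lw].$$ **Harmonic sums.** A harmonic word is $w=\binom{z_{d+1},\dots,z_1}{s_d,\dots,s_1}$ with $d\geq 0$, $z_i\in\mu_N(K)$, $s_i\ge1$; it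 is identified with the word $e_{z_{d+1}}e_0^{s_d-1}e_{z_d}\cdots e_0^{s_1-1}e_{z_1}$. Put $$har_n(w)=n^{s_d+\dots+s_1}\sum_{0<n_1<\dots<n_d<n}\frac{(z_2/z_1)^{n_1}\cdots(z_{d+1}/z_d)^{n_d}(1/z_{d+1})^n}{n_1^{s_1}\cdots n_d^{s_d}}.$$ Let $har_{\mathbb N}^{(p^\alpha)}$ be the sequence in $A\langle\langle e_Z\rangle\rangle^{DR-RT}_{har}$ whose coefficient at $e_0^lw$ ($l\ge0$, $w$ a harmonic word) is $har_n\binom{z_{d+1}^{p^\alpha},\dots,z_1^{p^\alpha}}{s_d,\dots,s_1}$, and whose coefficients at all other words are $0$. **Independence.** Let $\mathfrak A(\mathbb Z_p)$, resp. $\mathfrak A^\dagger(\mathbb Z_p)$, be the ring of functions of $n\in\mathbb Z_p$ given by power series with coefficients in $A$ that converge on the closed disc of radius $1$, resp. on a closed disc of some radius $>1$, around $0$. Let $\mathcal E^{\dagger}$, resp. $\mathcal E$, be the set of sequences $h$ in $A\langle\langle e_Z\rangle\rangle^{DR-RT}_{har}$ such that the functions $n\in\mathbb N^*\mapsto h_n(w)$,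 for all harmonic words $w$ (of any depth), are linearly independent over $\mathfrak A^\dagger(\mathbb Z_p)$, resp. over $\mathfrak A(\mathbb Z_p)$. Let $\mathrm{Orb}_{har_{\mathbb N}}=\{x\circ^{DR-RT}_{har}har^{(p^\alpha)}_{\mathbb N} : x\in \mathrm{Ad}_{\tilde\Pi(A)_\Sigma}(e_1)\}$. **Proposition.** (i) $har_{\mathbb N}^{(p^\alpha)}\in\mathcal E^{\dagger}$, and also $har_{\mathbb N}^{(p^\alpha)}\in\mathcal E$. (ii) $\mathcal E^{\dagger}$ is stable under $x\circ^{DR-RT}_{har}$ for all $x\in\mathrm{Ad}_{\tilde\Pi(A)_\Sigma^\dagger}(e_1)$, and $\mathcal E$ is stable under $x\circ^{DR-RT}_{har}$ for all $x\in\mathrm{Ad}_{\tilde\Pi(A)_\Sigma}(e_1)$; in both cases the limits that define the action exist. (iii) $\mathrm{Orb}_{har_{\mathbb N}}\subset\mathcal E^{\dagger}$, and also $\mathrm{Orb}_{har_{\mathbb N}}\subset\mathcal E$. -/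

import Mathlib

open Filter Topology

noncomputable section

namespace HarmonicIhara

/-! ### Words and non-commutative power series -/

/-- The alphabet `e_Z`: `none` is the letter `e₀`, and `some z` is the letter `e_z`, for `z ∈ μ_N(K)`. -/
abbrev Letter (N : ℕ) (K : Type*) [Field K] : Type _ := Option (rootsOfUnity N K)

/-- Words over `e_Z`, read from left to right. The weight of a word is its length. -/
abbrev Word (N : ℕ) (K : Type*) [Field K] : Type _ := List (Letter N K)

/-- The depth of a word: the number of its letters which are distinct from `e₀`. -/
def depth {N : ℕ} {K : Type*} [Field K] (w : Word N K) : ℕ := w.countP Option.isSome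

/-- `A⟨⟨e_Z⟩⟩`: a formal power series is the family of its coefficients `f[w]`. -/
abbrev NCSeries (N : ℕ) (K : Type*) [Field K] (A : Type*) : Type _ := Word N K → A

section Algebra

variable {N : ℕ} {K : Type*} [Field K] {A : Type*} [CommRing A]

/-- The product of `A⟨⟨e_Z⟩⟩` (concatenation): `(f g)[w] = ∑_{w = u v} f[u] g[v]`. -/
def ncMul (f g : NCSeries N K A) : NCSeries N K A := fun w =>
  ∑ i ∈ Finset.range (w.length + 1), f (w.take i) * g (w.drop i)

open Classical in
/-- The series consisting of a single word. -/
def single (u : Word N K) : NCSeries N K A := fun w => if w = u then 1 else 0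

/-- The list (with multiplicities) of the shuffles of two words. -/
def shuffle {L : Type*} : List L → List L → List (List L)
  | [], v => [v]
  | a :: u, [] => [a :: u]
  | a :: u, b :: v =>
      (shuffle u (b :: v)).map (fun w => a :: w) ++ (shuffle (a :: u) v).map (fun w => b :: w)

/-- The points of `Π_{1,0}` over `A`: the series with constant term `1` that satisfy the shuffle
equation `f[u] f[v] = f[u ⧢ v]`. -/
def PiPoints (N : ℕ) (K : Type*) [Field K] (A : Type*) [CommRing A] : Set (NCSeries N K A) :=
  {f | f [] = 1 ∧ ∀ u v, f u * f v = ((shuffle u v).map f).sum}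

/-- `Π̃_{1,0}(A)`: the points with `f[e₁] = f[e₀] = 0`. -/
def PiTilde (N : ℕ) (K : Type*) [Field K] (A : Type*) [CommRing A] : Set (NCSeries N K A) :=
  {f | f ∈ PiPoints N K A ∧ f [some 1] = 0 ∧ f [none] = 0}

/-- `Ad_S(e₁) = {g⁻¹ e₁ g : g ∈ S}`, for a set `S` of series with constant term `1`. Such a `g` is
invertible, so that `x = g⁻¹ e₁ g` means `g x = e₁ g`. -/
def adSet (S : Set (NCSeries N K A)) : Set (NCSeries N K A) :=
  {x | ∃ g ∈ S, ncMul g x = ncMul (single [some 1]) g}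

/-- `(t ↦ z t)_*`, the automorphism `e₀ ↦ e₀`, `e_{z'} ↦ e_{z z'}` of `A⟨⟨e_Z⟩⟩`. -/
def rotate (z : rootsOfUnity N K) (x : NCSeries N K A) : NCSeries N K A := fun w =>
  x (w.map (Option.map (fun z' => z⁻¹ * z')))

/-- The image of a word under the substitution `e₀ ↦ e₀`, `e_z ↦ (t ↦ z t)_* x`. -/
def substWord (x : NCSeries N K A) : Word N K → NCSeries N K A
  | [] => single []
  | none :: v => ncMul (single [none]) (substWord x v)
  | some z :: v => ncMul (rotate z x) (substWord x v)

/-- The adjoint Ihara product `x ∘_Ad h = h(e₀, (x^{(z)})_{z ∈ μ_N})`, where `x^{(z)} = (t ↦ z t)_* x`.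
For `h = f⁻¹ e₁ f` and `x = g⁻¹ e₁ g` it is the conjugate of `e₁` by the Ihara product of `g` and `f`.
If `x` has no constant term, the sum over the words `v` has only finitely many non-zero terms. -/
def adIhara (x h : NCSeries N K A) : NCSeries N K A := fun w =>
  ∑ᶠ v : Word N K, h v * substWord x v w

/-- If `x = g⁻¹ e₁ g`, this is `(τ(n) g)⁻¹ e₁ (τ(n) g)`, where `τ(n)` multiplies the coefficient of
each word by `n ^ weight`. -/
def adScale (n : ℕ) (x : NCSeries N K A) : NCSeries N K A := fun w =>
  (n : A) ^ (w.length - 1) * x w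

/-- `A⟨⟨e_Z⟩⟩^{DR-RT}_har`: the series such that `l ↦ f[e₀^l w]` is constant for every word `w`. -/
def drrtSpace (N : ℕ) (K : Type*) [Field K] (A : Type*) : Set (NCSeries N K A) :=
  {f | ∀ (w : Word N K) (l : ℕ), f (List.replicate l none ++ w) = f w}

end Algebra

/-! ### Conditions of decay, limits, and the harmonic Ihara action -/

section Normed

variable {N : ℕ} {K : Type*} [Field K] {A : Type*} [NormedCommRing A]

/-- `|f[w]| r^s → 0` when `s → ∞`, uniformly over the words `w` of weight `s` and depth `d`. -/
def DecaysAtRate (r : ℝ) (d : ℕ) (f : NCSeries N K A) : Prop :=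
  ∀ ε : ℝ, 0 < ε → ∃ S : ℕ, ∀ w : Word N K,
    depth w = d → S ≤ w.length → ‖f w‖ * r ^ w.length < ε

/-- `Π̃_{1,0}(A)_Σ`: in each depth `d ≥ 1`, the coefficients tend to `0` when the weight tends to
infinity. -/
def PiTildeSigma (N : ℕ) (K : Type*) [Field K] (A : Type*) [NormedCommRing A] :
    Set (NCSeries N K A) :=
  {f | f ∈ PiTilde N K A ∧ ∀ d : ℕ, 1 ≤ d → DecaysAtRate 1 d f}

/-- The overconvergent points of `Π̃_{1,0}(A)_Σ`: in each depth `d ≥ 1`, the coefficients tend to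
`0` geometrically fast when the weight tends to infinity. -/
def PiTildeSigmaDagger (N : ℕ) (K : Type*) [Field K] (A : Type*) [NormedCommRing A] :
    Set (NCSeries N K A) :=
  {f | f ∈ PiTilde N K A ∧ ∀ d : ℕ, 1 ≤ d → ∃ r : ℝ, 1 < r ∧ DecaysAtRate r d f}

/-- `A⟨⟨e_Z⟩⟩^lim`: the series such that `l ↦ f[e₀^l w]` converges for every word `w`. -/
def limSpace (N : ℕ) (K : Type*) [Field K] (A : Type*) [NormedCommRing A] : Set (NCSeries N K A) :=
  {f | ∀ w : Word N K, ∃ a : A,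
    Tendsto (fun l : ℕ => f (List.replicate l none ++ w)) atTop (𝓝 a)}

/-- The map `lim`, `(lim f)[w] = lim_{l → ∞} f[e₀^l w]`. -/
def limSeries (f : NCSeries N K A) : NCSeries N K A := fun w =>
  limUnder atTop (fun l : ℕ => f (List.replicate l none ++ w))

/-- The harmonic Ihara action `x ∘_har^{DR-RT} h : n ↦ lim (τ(n)(x) ∘_Ad h_n)`. -/
def harAction (x : NCSeries N K A) (h : ℕ → NCSeries N K A) : ℕ → NCSeries N K A := fun n =>
  limSeries (adIhara (adScale n x) (h n))

/-- The orbit of `h` under the action of `X` by `∘_har^{DR-RT}`. -/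
def harOrbit (X : Set (NCSeries N K A)) (h : ℕ → NCSeries N K A) : Set (ℕ → NCSeries N K A) :=
  {k | ∃ x ∈ X, k = harAction x h}

end Normed

/-! ### Multiple harmonic sums -/

/-- Harmonic words `(z_{d+1}, …, z_1 ; s_d, …, s_1)`, `d ≥ 0`, encoded as
`(z_{d+1}, [(s_d, z_d), …, (s_1, z_1)])`. -/
abbrev HarWord (N : ℕ) (K : Type*) [Field K] : Type _ :=
  rootsOfUnity N K × List (ℕ+ × rootsOfUnity N K)

section Har

variable {N : ℕ} {K : Type*} [Field K]

/-- The word `e_{z_{d+1}} e₀^{s_d-1} e_{z_d} ⋯ e₀^{s_1-1} e_{z_1}`. -/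
def HarWord.toWord (w : HarWord N K) : Word N K :=
  some w.1 :: w.2.flatMap (fun q => List.replicate ((q.1 : ℕ) - 1) none ++ [some q.2])

/-- The multiple harmonic sum
`∑_{0 < n_1 < … < n_d < n} (z_2/z_1)^{n_1} ⋯ (z_{d+1}/z_d)^{n_d} (1/z_{d+1})^n / (n_1^{s_1} ⋯ n_d^{s_d})`,
computed by summing over the largest index `m = n_d` last. -/
def mhs : rootsOfUnity N K → List (ℕ+ × rootsOfUnity N K) → ℕ → K
  | z, [], n => (((z : Kˣ) : K) ^ n)⁻¹
  | z, (s, z') :: t, n =>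
      (((z : Kˣ) : K) ^ n)⁻¹ *
        ∑ m ∈ Finset.Ioo 0 n, ((z : Kˣ) : K) ^ m * ((m : K) ^ (s : ℕ))⁻¹ * mhs z' t m

/-- The weighted multiple harmonic sum `har_n(w) = n^{s_d + ⋯ + s_1} · (multiple harmonic sum)`. -/
def har (w : HarWord N K) (n : ℕ) : K :=
  (n : K) ^ (w.2.map (fun q => (q.1 : ℕ))).sum * mhs w.1 w.2 n

/-- Replace every root of unity `z_i` in a harmonic word by `z_i ^ k`. -/
def HarWord.twist (k : ℕ) (w : HarWord N K) : HarWord N K :=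
  (w.1 ^ k, w.2.map (fun q => (q.1, q.2 ^ k)))

/-- The sequence `n ↦ har_n^{(k)}` (to be used with `k = p^α`) of elements of
`A⟨⟨e_Z⟩⟩^{DR-RT}_har`: the coefficient of `e₀^l e_{z_{d+1}} e₀^{s_d-1} e_{z_d} ⋯ e₀^{s_1-1} e_{z_1}`
is the weighted multiple harmonic sum of `(z_{d+1}^k, …, z_1^k ; s_d, …, s_1)`, for all `l ≥ 0`;
the other words do not index multiple harmonic sums and have coefficient `0`. -/
def harSeq (N : ℕ) (K : Type*) [Field K] (A : Type*) [CommRing A] [Algebra K A] (k : ℕ) :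
    ℕ → NCSeries N K A := fun n =>
  Function.extend (fun q : ℕ × HarWord N K => List.replicate q.1 none ++ q.2.toWord)
    (fun q => algebraMap K A (har (q.2.twist k) n)) 0

end Har

/-! ### Rings of analytic functions of `n ∈ ℤ_p`, restricted to `n ∈ ℕ*` -/

section Analytic

variable {A : Type*} [NormedCommRing A]

/-- `f` is the restriction to `ℕ*` of (the sum of) a power series with coefficients in `A` which
converges on the closed disc of radius `r` around `0`. -/
def IsAnalyticOfRadius (r : ℝ) (f : ℕ+ → A) : Prop :=
  ∃ F : PowerSeries A, PowerSeries.IsRestricted r F ∧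
    ∀ n : ℕ+, HasSum (fun k : ℕ => PowerSeries.coeff k F * ((n : ℕ) : A) ^ k) (f n)

theorem IsAnalyticOfRadius.const (r : ℝ) (a : A) :
    IsAnalyticOfRadius r (fun _ => a : ℕ+ → A) := by
  refine ⟨PowerSeries.C a, PowerSeries.isRestricted_C r a, fun n => ?_⟩
  convert hasSum_ite_eq (0 : ℕ) a using 2 with k
  by_cases hk : k = 0 <;> simp [PowerSeries.coeff_C, hk]

theorem IsAnalyticOfRadius.add {r : ℝ} {f g : ℕ+ → A} (hf : IsAnalyticOfRadius r f)
    (hg : IsAnalyticOfRadius r g) : IsAnalyticOfRadius r (f + g) := by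
  obtain ⟨F, hF, hF'⟩ := hf
  obtain ⟨G, hG, hG'⟩ := hg
  refine ⟨F + G, PowerSeries.isRestricted.add r hF hG, fun n => ?_⟩
  simpa [add_mul] using (hF' n).add (hG' n)

theorem IsAnalyticOfRadius.neg {r : ℝ} {f : ℕ+ → A} (hf : IsAnalyticOfRadius r f) :
    IsAnalyticOfRadius r (-f) := by
  obtain ⟨F, hF, hF'⟩ := hf
  refine ⟨-F, PowerSeries.isRestricted.neg r hF, fun n => ?_⟩
  simpa using (hF' n).neg

theorem IsAnalyticOfRadius.mul [IsUltrametricDist A] {r : ℝ} {f g : ℕ+ → A}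
    (hf : IsAnalyticOfRadius r f) (hg : IsAnalyticOfRadius r g) :
    IsAnalyticOfRadius r (f * g) := by
  obtain ⟨F, hF, hF'⟩ := hf
  obtain ⟨G, hG, hG'⟩ := hg
  refine ⟨F * G, PowerSeries.isRestricted.mul r hF hG, fun n => ?_⟩
  have : NonarchimedeanRing A :=
    { is_nonarchimedean := NonarchimedeanAddGroup.is_nonarchimedean (G := A) }
  have h := (hF' n).mul_of_nonarchimedean (hG' n)
  rw [← Finset.HasAntidiagonal.sigmaAntidiagonalEquivProd.hasSum_iff] at h
  rw [Pi.mul_apply]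
  convert h.sigma (fun k => hasSum_fintype _) using 2 with k
  rw [PowerSeries.coeff_mul, Finset.sum_mul, ← Finset.sum_coe_sort]
  refine Finset.sum_congr rfl fun q _ => ?_
  have hq : (q : ℕ × ℕ).1 + (q : ℕ × ℕ).2 = k :=
    Finset.HasAntidiagonal.mem_antidiagonal.1 q.2
  simp only [Function.comp_apply, Finset.HasAntidiagonal.sigmaAntidiagonalEquivProd_apply]
  have hp : ((n : ℕ) : A) ^ k =
      ((n : ℕ) : A) ^ (q : ℕ × ℕ).1 * ((n : ℕ) : A) ^ (q : ℕ × ℕ).2 := by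
    rw [← pow_add, hq]
  rw [hp]
  ring

theorem IsAnalyticOfRadius.mono {r r' : ℝ} (hr : 0 ≤ r') (hrr : r' ≤ r) {f : ℕ+ → A}
    (hf : IsAnalyticOfRadius r f) : IsAnalyticOfRadius r' f := by
  obtain ⟨F, hF, hF'⟩ := hf
  refine ⟨F, ?_, hF'⟩
  rw [PowerSeries.isRestricted_iff'] at hF ⊢
  refine squeeze_zero (fun k => by positivity) (fun k => ?_) hF
  gcongr

variable [IsUltrametricDist A]

/-- `𝔄(ℤ_p)`: rigid analytic functions of `n ∈ ℤ_p` with coefficients in `A`, i.e. sums of power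
series which converge on the closed unit disc. Since `ℕ*` is dense in `ℤ_p`, such a function is
determined by its restriction to `ℕ*`, by which it is represented. -/
def analyticRing (A : Type*) [NormedCommRing A] [IsUltrametricDist A] : Subring (ℕ+ → A) where
  carrier := {f | IsAnalyticOfRadius 1 f}
  mul_mem' hf hg := hf.mul hg
  one_mem' := .const 1 1
  add_mem' hf hg := hf.add hg
  zero_mem' := .const 1 0
  neg_mem' hf := hf.neg

/-- `𝔄†(ℤ_p)`: overconvergent functions of `n ∈ ℤ_p` with coefficients in `A`, i.e. sums of power
series which converge on a closed disc around `0` of some radius `> 1` (restricted to `ℕ*`). -/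
def overconvergentRing (A : Type*) [NormedCommRing A] [IsUltrametricDist A] :
    Subring (ℕ+ → A) where
  carrier := {f | ∃ r : ℝ, 1 < r ∧ IsAnalyticOfRadius r f}
  mul_mem' := by
    rintro f g ⟨r, hr, hf⟩ ⟨s, hs, hg⟩
    have h1 : 1 < min r s := lt_min hr hs
    exact ⟨min r s, h1, (hf.mono (by linarith) (min_le_left _ _)).mul
      (hg.mono (by linarith) (min_le_right _ _))⟩
  one_mem' := ⟨2, one_lt_two, .const 2 1⟩
  add_mem' := by
    rintro f g ⟨r, hr, hf⟩ ⟨s, hs, hg⟩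
    have h1 : 1 < min r s := lt_min hr hs
    exact ⟨min r s, h1, (hf.mono (by linarith) (min_le_left _ _)).add
      (hg.mono (by linarith) (min_le_right _ _))⟩
  zero_mem' := ⟨2, one_lt_two, .const 2 0⟩
  neg_mem' := by
    rintro f ⟨r, hr, hf⟩
    exact ⟨r, hr, hf.neg⟩

/-- The set of the sequences `h = (h_n)` in `A⟨⟨e_Z⟩⟩^{DR-RT}_har` such that the functions
`n ∈ ℕ* ↦ h_n(w)`, for `w` running through the harmonic words of all depths, are linearly
independent over the ring `R` of functions of `n`. For `R = 𝔄†(ℤ_p)` this is `𝓔^{DR-RT}_har`. -/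
def independentSequences (N : ℕ) (K : Type*) [Field K] {A : Type*} [NormedCommRing A]
    (R : Subring (ℕ+ → A)) : Set (ℕ → NCSeries N K A) :=
  {h | (∀ n, h n ∈ drrtSpace N K A) ∧
    LinearIndependent R (fun (w : HarWord N K) (n : ℕ+) => h n w.toWord)}

end Analytic

end HarmonicIhara

end

open HarmonicIhara

/-! Stability. A series `g` satisfying the shuffle equation with g[e₀] = 0 vanishes at e₀^k for k ≥
1, so x = g⁻¹e₁g is e₁ plus terms of depth at least 2 (`adSet_depth_one`), and substituting x_n
fixes each word up to words of larger depth (`substWord_of_depth_le`). Since h_n ignores leading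
letters e₀, the coefficient at e₀^l w of the substituted series is a partial sum, indexed by l, of a
series (`adIhara_replicate_append`). For w harmonic its limit is h_n(w) plus a finite combination of
the h_n(v), v harmonic of smaller depth. The multipliers are built from power series in n with
coefficients x[e₀^i u], so they lie in the ring permitted by the decay of g. A unitriangular change
of family for the depth preserves independence (`linearIndependent_of_triangular`).

Independence of harmonic sums. Their values lie in the locally compact field L = ℚ_p(ξ), and bounded
linear forms A → L, from an ultrametric Hahn–Banach argument, reduce the coefficients of a relation
to L. Germs at infinity of quotients of power series converging on the closed unit ball form a
field, because a nonzero such series has finitely many zeros. In a relation F = ∑ g_w H_w = 0,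
normalize one coefficient of maximal depth, g_u = 1, and form F(n) − z_u F(n+1) by means of z
H_w(n+1) = H_w(n) + n^{-s} H_{w'}(n), where w' is w without its outermost index. The coefficient of
u cancels, so by induction the new relation is trivial. The top coefficients are therefore
constants, and at the tail v of u one gets g_v(n) − c g_v(n+1) = Q(1/n) with Q nonconstant. A pole
of g_v at 0 or 1 would propagate to infinitely many integers, so there is none, whereas Q(1/n) is
unbounded near 0 (`not_eventually_sub_shift_eq`).

Orbit. Independence over analytic functions implies independence over the overconvergent subring, so
both inclusions follow from stability over the larger ring. -/

namespace HarmonicIhara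

/-! ### Words, depth, and the leading term of a substitution. -/

section Words

variable {N : ℕ} {K : Type*} [Field K] {A : Type*} [CommRing A]

theorem depth_cons (a : Letter N K) (w : Word N K) :
    depth (a :: w) = depth w + if a.isSome then 1 else 0 := by
  simp [depth, List.countP_cons]

theorem depth_append (v w : Word N K) : depth (v ++ w) = depth v + depth w := by
  simp [depth]

theorem depth_replicate_none (l : ℕ) : depth (List.replicate l none : Word N K) = 0 := by
  simp [depth]

theorem depth_eq_zero_iff {w : Word N K} : depth w = 0 ↔ w = List.replicate w.length none := by
  rw [depth, List.countP_eq_zero, List.eq_replicate_iff]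
  simp

theorem depth_take_add_depth_drop (i : ℕ) (w : Word N K) :
    depth (w.take i) + depth (w.drop i) = depth w := by
  rw [← depth_append, List.take_append_drop]

theorem depth_map_rotate (z : rootsOfUnity N K) (w : Word N K) :
    depth (w.map (Option.map (fun z' => z⁻¹ * z'))) = depth w := by
  simp [depth, List.countP_map, Function.comp_def]

theorem ncMul_single_nil (a : Letter N K) (f : NCSeries N K A) :
    ncMul (single [a]) f [] = 0 := by
  simp [ncMul, single]

theorem ncMul_single_cons (a b : Letter N K) (f : NCSeries N K A) (u : Word N K) :
    ncMul (single [a]) f (b :: u) = open Classical in if b = a then f u else 0 := by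
  classical
  rw [ncMul, Finset.sum_eq_single 1]
  · simp [single]
  · intro i _ hi
    rcases i with _ | _ | i
    · simp [single]
    · exact absurd rfl hi
    · rcases u with _ | ⟨c, u⟩
      · simp_all
      · simp [single]
  · simp

/-- The coefficients of a product whose first factor has no part of depth `0`, at a word
preceded by a power of `e₀`. -/
theorem ncMul_replicate_append {f : NCSeries N K A} (hf : ∀ u, depth u = 0 → f u = 0)
    (g : NCSeries N K A) (i : ℕ) (w : Word N K) :
    ncMul f g (List.replicate i none ++ w) = ∑ j ∈ Finset.range w.length,
      f (List.replicate i none ++ w.take (j + 1)) * g (w.drop (j + 1)) := by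
  have hl : (List.replicate i (none : Letter N K) ++ w).length + 1 = (i + 1) + w.length := by
    simp; ring
  -- The first `i + 1` cuts leave a power of `e₀` on the left, where `f` vanishes.
  rw [ncMul, hl, Finset.sum_range_add, Finset.sum_eq_zero, zero_add]
  · refine Finset.sum_congr rfl fun j _ => ?_
    have h1 : i + 1 + j - i = j + 1 := by omega
    rw [List.take_append, List.drop_append]
    simp [h1, show min (i + 1 + j) i = i by omega, show i - (i + 1 + j) = 0 by omega]
  · intro j hj
    have : j ≤ i := by simpa [Nat.lt_succ_iff] using hj
    rw [hf, zero_mul]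
    rw [List.take_append, List.take_replicate]
    simp [this, depth_replicate_none]

theorem rotate_eq_zero {x : NCSeries N K A} (hx : ∀ u, depth u = 0 → x u = 0)
    (z : rootsOfUnity N K) (u : Word N K) (hu : depth u = 0) : rotate z x u = 0 :=
  hx _ (by rw [depth_map_rotate, hu])

theorem substWord_eq_zero_of_length_lt {x : NCSeries N K A} (hx : x [] = 0) (v u : Word N K)
    (h : u.length < v.length) : substWord x v u = 0 := by
  induction v generalizing u with
  | nil => simp at h
  | cons a v ih =>
    cases a with
    | none =>
      rw [substWord]
      cases u with
      | nil => exact ncMul_single_nil _ _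
      | cons b u =>
        rw [ncMul_single_cons, ih u (by simpa using h), ite_self]
    | some z =>
      rw [substWord, ncMul]
      refine Finset.sum_eq_zero fun i hi => ?_
      rcases i with _ | i
      · simp [rotate, hx]
      · rw [ih, mul_zero]
        simp at h hi ⊢
        omega

/-- The leading term, for the depth, of the image of a word by a substitution. -/
theorem substWord_of_depth_le {x : NCSeries N K A} (hx0 : ∀ u, depth u = 0 → x u = 0)
    (hx1 : ∀ u, depth u = 1 → x u = open Classical in if u = [some 1] then 1 else 0)
    (v u : Word N K) (h : depth u ≤ depth v) :
    substWord x v u = open Classical in if u = v then 1 else 0 := by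
  classical
  induction v generalizing u with
  | nil => simp [substWord, single]
  | cons a v ih =>
    cases a with
    | none =>
      rw [substWord]
      cases u with
      | nil => simp [ncMul_single_nil]
      | cons b u =>
        rw [ncMul_single_cons]
        by_cases hb : b = none
        · subst hb
          rw [if_pos rfl, ih u (by simpa [depth_cons] using h)]
          simp
        · simp [hb]
    | some z =>
      have key : ∀ i, rotate z x (u.take i) * substWord x v (u.drop i) =
          if u.take i = [some z] then substWord x v (u.drop i) else 0 := by
        intro i
        have hd := depth_take_add_depth_drop i u
        rw [depth_cons] at h
        simp only [Option.isSome_some, if_true] at h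
        -- A prefix of depth 0 is killed by `x`, one of depth 1 must be `e_z`, and one of depth at
        -- least 2 leaves a suffix shallower than `v`, where the induction gives 0.
        rcases Nat.lt_trichotomy (depth (u.take i)) 1 with h1 | h1 | h1
        · rw [rotate_eq_zero hx0 z _ (by omega), if_neg, zero_mul]
          intro h2
          rw [h2] at h1
          simp [depth] at h1
        · rw [rotate, hx1 _ (by rw [depth_map_rotate, h1])]
          have : (u.take i).map (Option.map (fun z' => z⁻¹ * z')) = [some 1] ↔
              u.take i = [some z] := by
            rw [List.map_eq_singleton_iff]
            constructor
            · rintro ⟨a, ha, hb⟩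
              rw [ha]
              cases a with
              | none => simp at hb
              | some y =>
                simp only [Option.map_some, Option.some.injEq, inv_mul_eq_one] at hb
                rw [hb]
            · intro h
              exact ⟨some z, h, by simp⟩
          simp only [this, ite_mul, one_mul, zero_mul]
        · rw [ih _ (by omega), if_neg]
          · simp
          · intro h2
            rw [h2] at hd
            omega
      rw [substWord, ncMul, Finset.sum_congr rfl fun i _ => key i]
      cases u with
      | nil => simp
      | cons b u =>
        rw [Finset.sum_eq_single 1]
        · rw [depth_cons, depth_cons] at h
          by_cases hb : b = some z
          · subst hb
            simp only [Option.isSome_some, if_true] at h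
            simp [ih u (by omega)]
          · simp [hb]
        · intro i hi hi1
          rw [if_neg]
          intro h2
          have := congrArg List.length h2
          simp at this hi
          omega
        · simp

theorem adScale_apply_depth_zero {x : NCSeries N K A} (hx0 : ∀ u, depth u = 0 → x u = 0) (n : ℕ)
    (u : Word N K) (hu : depth u = 0) : adScale n x u = 0 := by
  rw [adScale, hx0 u hu, mul_zero]

theorem adScale_apply_depth_one {x : NCSeries N K A}
    (hx1 : ∀ u, depth u = 1 → x u = open Classical in if u = [some 1] then 1 else 0) (n : ℕ)
    (u : Word N K) (hu : depth u = 1) :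
    adScale n x u = open Classical in if u = [some 1] then 1 else 0 := by
  rw [adScale, hx1 u hu]
  split_ifs with h <;> simp [h]

end Words

/-! ### The shape of g⁻¹ e₁ g in low depth. -/

section PiTilde

variable {N : ℕ} {K : Type*} [Field K] {A : Type*} [CommRing A]

theorem shuffle_singleton_replicate {L : Type*} (a : L) (k : ℕ) :
    shuffle [a] (List.replicate k a) =
      List.replicate (k + 1) (List.replicate (k + 1) a) := by
  induction k with
  | zero => simp [shuffle]
  | succ k ih =>
    rw [List.replicate_succ, shuffle, ih]
    simp [shuffle, ← List.replicate_succ]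

/-- The shuffle e₀ ⧢ e₀^k = (k+1) e₀^{k+1} gives (k+1) g[e₀^{k+1}] = g[e₀] g[e₀^k] = 0, and k+1 is
invertible. -/
theorem PiTilde_eq_zero_of_depth_eq_zero [Algebra ℚ A] {g : NCSeries N K A}
    (hg : g ∈ PiTilde N K A) {u : Word N K} (hu : depth u = 0) (hne : u ≠ []) : g u = 0 := by
  rw [depth_eq_zero_iff] at hu
  rw [hu]
  obtain ⟨⟨-, hsh⟩, -, h0⟩ := hg
  cases hk : u.length with
  | zero => exact absurd (List.length_eq_zero_iff.1 hk) hne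
  | succ k =>
    have h := hsh [none] (List.replicate k none)
    rw [shuffle_singleton_replicate, h0, zero_mul, List.map_replicate, List.sum_replicate,
      nsmul_eq_mul] at h
    have hu : IsUnit ((k + 1 : ℕ) : A) := by
      have : IsUnit ((k + 1 : ℕ) : ℚ) := isUnit_iff_ne_zero.2 (by positivity)
      simpa using this.map (algebraMap ℚ A)
    exact (hu.mul_right_eq_zero.1 h.symm)

/-- The recursive formula for the coefficients of `g⁻¹ e₁ g`. -/
theorem adSet_apply {g x : NCSeries N K A} (hg : g [] = 1)
    (hx : ncMul g x = ncMul (single [some 1]) g) (w : Word N K) :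
    x w = ncMul (single [some 1]) g w -
      ∑ i ∈ Finset.range w.length, g (w.take (i + 1)) * x (w.drop (i + 1)) := by
  rw [← hx, ncMul, Finset.sum_range_succ']
  simp [hg]

theorem adSet_depth_zero {g x : NCSeries N K A} (hg : g [] = 1)
    (hg0 : ∀ u, depth u = 0 → u ≠ [] → g u = 0)
    (hx : ncMul g x = ncMul (single [some 1]) g) (w : Word N K) (hw : depth w = 0) :
    x w = 0 := by
  rw [adSet_apply hg hx, Finset.sum_eq_zero, sub_zero]
  · cases w with
    | nil => exact ncMul_single_nil _ _
    | cons b w =>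
      rw [ncMul_single_cons, if_neg]
      rintro rfl
      simp [depth_cons] at hw
  · intro i hi
    rw [hg0, zero_mul]
    · have := depth_take_add_depth_drop (i + 1) w
      omega
    · intro h
      have := congrArg List.length h
      rw [List.length_take, List.length_nil] at this
      rw [Finset.mem_range] at hi
      omega

/-- In the recursion, a cut of a word of depth 1 has depth 0 on one side: on the left `g` vanishes,
on the right `x` does. What remains comes from `e₁ g`. This is the source of unitriangularity. -/
theorem adSet_depth_one {g x : NCSeries N K A} (hg : g [] = 1)
    (hg0 : ∀ u, depth u = 0 → u ≠ [] → g u = 0)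
    (hx : ncMul g x = ncMul (single [some 1]) g) (w : Word N K) (hw : depth w = 1) :
    x w = open Classical in if w = [some 1] then 1 else 0 := by
  classical
  rw [adSet_apply hg hx, Finset.sum_eq_zero, sub_zero]
  · cases w with
    | nil => simp [depth] at hw
    | cons b w =>
      rw [ncMul_single_cons]
      by_cases hb : b = some 1
      · subst hb
        rw [depth_cons] at hw
        by_cases hw' : w = []
        · simp [hw', hg]
        · simp [hw', hg0 w (by simpa using hw) hw']
      · simp [hb]
  · intro i hi
    have := depth_take_add_depth_drop (i + 1) w
    by_cases h : depth (w.take (i + 1)) = 0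
    · rw [hg0 _ h, zero_mul]
      intro h
      have := congrArg List.length h
      rw [List.length_take, List.length_nil] at this
      rw [Finset.mem_range] at hi
      omega
    · rw [adSet_depth_zero hg hg0 hx (w.drop (i + 1)) (by omega), mul_zero]

/-- Transfers decay along powers of e₀ from `g` to `x`: the number of terms does not depend on `i`.
At least one leading e₀ is required, so that the word does not occur in `e₁ g`. -/
theorem adSet_replicate_append {g x : NCSeries N K A} (hg : g [] = 1)
    (hg0 : ∀ u, depth u = 0 → u ≠ [] → g u = 0)
    (hx : ncMul g x = ncMul (single [some 1]) g) (i : ℕ) (w : Word N K) :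
    x (List.replicate (i + 1) none ++ w) =
      -∑ j ∈ Finset.range w.length,
        g (List.replicate (i + 1) none ++ w.take (j + 1)) * x (w.drop (j + 1)) := by
  classical
  -- Removing the constant term of `g` leaves a series without part of depth 0, as
  -- `ncMul_replicate_append` demands.
  have h0 : ∀ u, depth u = 0 → (g - single [] : NCSeries N K A) u = 0 := by
    intro u hu
    by_cases h : u = []
    · simp [h, hg, single]
    · simp [h, hg0 u hu h, single]
  have h1 := congrFun hx (List.replicate (i + 1) none ++ w)
  have h2 := ncMul_replicate_append h0 x (i + 1) w
  have h3 : ncMul (g - single [] : NCSeries N K A) x (List.replicate (i + 1) none ++ w) =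
      ncMul g x (List.replicate (i + 1) none ++ w) - x (List.replicate (i + 1) none ++ w) := by
    simp only [ncMul, Pi.sub_apply, sub_mul, Finset.sum_sub_distrib]
    congr 1
    rw [Finset.sum_eq_single 0]
    · simp [single]
    · intro j hj hj0
      rw [single, if_neg, zero_mul]
      intro h
      have := congrArg List.length h
      simp at this hj
      omega
    · simp
  rw [h1, h2] at h3
  rw [List.replicate_succ, List.cons_append, ncMul_single_cons, if_neg (by simp), zero_sub,
    ← List.cons_append, ← List.replicate_succ] at h3
  rw [← neg_eq_iff_eq_neg.2 h3, neg_inj]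
  exact Finset.sum_congr rfl fun j _ => by simp [single]

end PiTilde

/-! ### Unitriangular changes of a linearly independent family. -/

section Triangular

/-- A family which differs from a linearly independent one by a triangular change of vectors, for
a grading of the indices by natural numbers, is linearly independent. -/
theorem linearIndependent_of_triangular {R M ι : Type*} [Ring R] [AddCommGroup M] [Module R M]
    {b b' : ι → M} (hb : LinearIndependent R b) (deg : ι → ℕ)
    (h : ∀ i, b' i - b i ∈ Submodule.span R (b '' {j | deg j < deg i})) :
    LinearIndependent R b' := by
  classical
  have h' : ∀ i, ∃ c : ι →₀ R, (∀ j, c j ≠ 0 → deg j < deg i) ∧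
      Finsupp.linearCombination R b c = b' i - b i := by
    intro i
    obtain ⟨c, hc, hc'⟩ := (Finsupp.mem_span_image_iff_linearCombination R).1 (h i)
    refine ⟨c, fun j hj => ?_, hc'⟩
    exact (Finsupp.mem_supported R c).1 hc (Finsupp.mem_support_iff.2 hj)
  choose c hc hc' using h'
  rw [linearIndependent_iff] at hb ⊢
  intro f hf
  let φ : (ι →₀ R) →ₗ[R] (ι →₀ R) :=
    Finsupp.linearCombination R fun i => Finsupp.single i 1 + c i
  have hφ : Finsupp.linearCombination R b (φ f) = Finsupp.linearCombination R b' f := by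
    have : (Finsupp.linearCombination R b).comp φ = Finsupp.linearCombination R b' := by
      refine Finsupp.lhom_ext' fun i => LinearMap.ext_ring ?_
      simp [φ, hc']
    exact LinearMap.congr_fun this f
  have h0 : φ f = 0 := hb _ (hφ.trans hf)
  by_contra hne
  obtain ⟨i, hi, hmax⟩ := f.support.exists_max_image deg (Finsupp.support_nonempty_iff.2 hne)
  -- At an index of maximal degree in the support of `f`, the correction terms `c j` contribute
  -- nothing.
  have h1 : φ f i = f i := by
    simp only [φ, Finsupp.linearCombination_apply, Finsupp.sum, Finsupp.coe_finsetSum,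
      Finset.sum_apply, Finsupp.smul_apply, Finsupp.add_apply, smul_eq_mul]
    rw [Finset.sum_eq_single i]
    · have : c i i = 0 := by
        by_contra h
        exact lt_irrefl _ (hc i i h)
      simp [this]
    · intro j hj hji
      have : c j i = 0 := by
        by_contra h
        exact absurd (hmax j hj) (not_le.2 (hc j i h))
      simp [this, hji]
    · intro h
      exact absurd hi h
  rw [h0] at h1
  exact (Finsupp.mem_support_iff.1 hi) h1.symm

end Triangular

/-! ### Sequences whose power series in n lies in a given ring. -/

section Summation

variable {A : Type*} [NormedCommRing A]

/-- The coefficients `a i` tend to `0`, and `∑ i, a i * n ^ i` is, as a function of `n`, an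
element of `R`. -/
def SumsIn (R : Subring (ℕ+ → A)) (a : ℕ → A) : Prop :=
  Tendsto a atTop (𝓝 0) ∧ ∃ f ∈ R, ∀ n : ℕ+, HasSum (fun i => a i * ((n : ℕ) : A) ^ i) (f n)

variable {R : Subring (ℕ+ → A)}

theorem SumsIn.mul_const (hR : ∀ a : A, (fun _ => a) ∈ R) {a : ℕ → A} (ha : SumsIn R a) (c : A) :
    SumsIn R (fun i => a i * c) := by
  obtain ⟨h0, f, hf, hs⟩ := ha
  refine ⟨by simpa using h0.mul_const c, f * fun _ => c, R.mul_mem hf (hR c), fun n => ?_⟩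
  have h := (hs n).mul_right c
  simp only [mul_right_comm _ _ c] at h
  exact h

theorem SumsIn.neg {a : ℕ → A} (ha : SumsIn R a) : SumsIn R (fun i => -a i) := by
  obtain ⟨h0, f, hf, hs⟩ := ha
  exact ⟨by simpa using h0.neg, -f, R.neg_mem hf, fun n => by simpa using (hs n).neg⟩

theorem SumsIn.sum {ι : Type*} (s : Finset ι) {a : ι → ℕ → A} (ha : ∀ j ∈ s, SumsIn R (a j)) :
    SumsIn R (fun i => ∑ j ∈ s, a j i) := by
  classical
  choose! h0 f hf hs using ha
  refine ⟨by simpa using tendsto_finsetSum s h0, ∑ j ∈ s, f j, R.sum_mem hf, fun n => ?_⟩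
  simpa [Finset.sum_mul, Finset.sum_apply] using hasSum_sum fun j hj => hs j hj n

theorem sumsIn_ite_zero (hR : ∀ a : A, (fun _ => a) ∈ R) (c : A) :
    SumsIn R (fun i => if i = 0 then c else 0) := by
  refine ⟨tendsto_const_nhds.congr' ?_, _, hR c, fun n => ?_⟩
  · filter_upwards [eventually_gt_atTop 0] with i hi
    simp [hi.ne']
  · convert hasSum_ite_eq (0 : ℕ) c using 2 with i
    split_ifs with h <;> simp [h]

theorem SumsIn.add {a b : ℕ → A} (ha : SumsIn R a) (hb : SumsIn R b) :
    SumsIn R (fun i => a i + b i) := by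
  simpa using SumsIn.sum (Finset.univ : Finset Bool) (a := fun j => if j then a else b)
    (by rintro (_ | _) _ <;> simpa)

theorem id_isAnalyticOfRadius (r : ℝ) :
    IsAnalyticOfRadius r (fun n : ℕ+ => ((n : ℕ) : A)) := by
  refine ⟨PowerSeries.X, PowerSeries.isRestricted_monomial r 1 1, fun n => ?_⟩
  convert hasSum_ite_eq (1 : ℕ) ((n : ℕ) : A) using 2 with k
  by_cases hk : k = 1 <;> simp [PowerSeries.coeff_X, hk]

variable [IsUltrametricDist A]

theorem norm_mul_natCast_pow_le (a : A) (n i : ℕ) : ‖a * (n : A) ^ i‖ ≤ ‖a‖ := by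
  rw [← Nat.cast_pow, mul_comm, ← nsmul_eq_mul]
  exact IsUltrametricDist.norm_nsmul_le _ _

variable [CompleteSpace A]

theorem summable_mul_natCast_pow {a : ℕ → A} (ha : Tendsto a atTop (𝓝 0)) (n : ℕ) :
    Summable (fun i => a i * (n : A) ^ i) := by
  rw [NonarchimedeanAddGroup.summable_iff_tendsto_cofinite_zero, Nat.cofinite_eq_atTop]
  exact squeeze_zero_norm (fun i => norm_mul_natCast_pow_le _ _ _)
    (tendsto_zero_iff_norm_tendsto_zero.1 ha)

theorem exists_isAnalyticOfRadius {a : ℕ → A} {r : ℝ} (hr : 1 ≤ r)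
    (ha : Tendsto (fun i => ‖a i‖ * r ^ i) atTop (𝓝 0)) :
    Tendsto a atTop (𝓝 0) ∧ ∃ f, IsAnalyticOfRadius r f ∧
      ∀ n : ℕ+, HasSum (fun i => a i * ((n : ℕ) : A) ^ i) (f n) := by
  have h0 : Tendsto a atTop (𝓝 0) := by
    refine squeeze_zero_norm (fun i => ?_) ha
    exact le_mul_of_one_le_right (norm_nonneg _) (one_le_pow₀ hr)
  refine ⟨h0, fun n => ∑' i, a i * ((n : ℕ) : A) ^ i, ⟨PowerSeries.mk a, ?_, fun n => ?_⟩,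
    fun n => (summable_mul_natCast_pow h0 n).hasSum⟩
  · rw [PowerSeries.isRestricted_iff']
    simpa using ha
  · simpa using (summable_mul_natCast_pow h0 n).hasSum

end Summation

/-! ### Decay of coefficients along powers of e₀. -/

section Decay

variable {N : ℕ} {K : Type*} [Field K] {A : Type*} [NormedCommRing A]

/-- Prefixing powers of e₀ keeps the depth and raises the weight to at least `i`; for `r ≥ 1` the
uniform decay in a fixed depth then bounds the sequence. -/
theorem DecaysAtRate.tendsto_replicate {r : ℝ} (hr : 1 ≤ r) {d : ℕ} {f : NCSeries N K A}
    (hf : DecaysAtRate r d f) (u : Word N K) (hu : depth u = d) :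
    Tendsto (fun i => ‖f (List.replicate i none ++ u)‖ * r ^ i) atTop (𝓝 0) := by
  rw [Metric.tendsto_atTop]
  intro ε hε
  obtain ⟨S, hS⟩ := hf ε hε
  refine ⟨S, fun i hi => ?_⟩
  have h := hS (List.replicate i none ++ u)
    (by rw [depth_append, depth_replicate_none, zero_add, hu]) (by simp; omega)
  rw [Real.dist_eq, sub_zero, abs_of_nonneg (by positivity)]
  refine lt_of_le_of_lt ?_ h
  gcongr
  simp

variable [IsUltrametricDist A] [CompleteSpace A]

theorem sumsIn_of_mem_PiTildeSigma {f : NCSeries N K A} (hf : f ∈ PiTildeSigma N K A)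
    (u : Word N K) (hu : depth u ≠ 0) :
    SumsIn (analyticRing A) (fun i => f (List.replicate i none ++ u)) :=
  exists_isAnalyticOfRadius le_rfl
    ((hf.2 _ (Nat.one_le_iff_ne_zero.2 hu)).tendsto_replicate le_rfl u rfl)

theorem sumsIn_of_mem_PiTildeSigmaDagger {f : NCSeries N K A}
    (hf : f ∈ PiTildeSigmaDagger N K A) (u : Word N K) (hu : depth u ≠ 0) :
    SumsIn (overconvergentRing A) (fun i => f (List.replicate i none ++ u)) := by
  obtain ⟨r, hr, h⟩ := hf.2 _ (Nat.one_le_iff_ne_zero.2 hu)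
  obtain ⟨h1, f, hf, h2⟩ := exists_isAnalyticOfRadius hr.le (h.tendsto_replicate hr.le u rfl)
  exact ⟨h1, f, ⟨r, hr, hf⟩, h2⟩

end Decay

/-! ### Passage of the decay from g to g⁻¹ e₁ g. -/

section AdSet

variable {N : ℕ} {K : Type*} [Field K] {A : Type*} [NormedCommRing A] {R : Subring (ℕ+ → A)}

/-- The decay of the coefficients of `g` implies that of the coefficients of `g⁻¹ e₁ g`. -/
theorem sumsIn_adSet (hR : ∀ a : A, (fun _ => a) ∈ R) {g x : NCSeries N K A} (hg : g [] = 1)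
    (hg0 : ∀ u, depth u = 0 → u ≠ [] → g u = 0)
    (hx : ncMul g x = ncMul (single [some 1]) g)
    (hgR : ∀ u, depth u ≠ 0 → SumsIn R (fun i => g (List.replicate i none ++ u)))
    (z : rootsOfUnity N K) (w : Word N K) :
    SumsIn R (fun i => x (List.replicate i none ++ some z :: w)) := by
  set u : Word N K := some z :: w with hu
  have hs : SumsIn R (fun i => -∑ j ∈ Finset.range u.length,
        g (List.replicate i none ++ u.take (j + 1)) * x (u.drop (j + 1))) := by
    refine (SumsIn.sum _ fun j _ => (hgR (u.take (j + 1)) ?_).mul_const hR _).neg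
    simp [hu, depth_cons]
  -- The formula for positive powers of e₀ misses the `e₁ g` term at `i = 0`; a sequence supported
  -- at 0 restores it.
  convert hs.add (sumsIn_ite_zero hR (ncMul (single [some 1]) g u)) using 2 with i
  cases i with
  | zero => simp [adSet_apply hg hx u, sub_eq_neg_add]
  | succ i => simp [adSet_replicate_append hg hg0 hx i u]

end AdSet

/-! ### The adjoint Ihara product at e₀^l w as a partial sum. -/

section FiniteSums

variable {N : ℕ} {K : Type*} [Field K] {A : Type*} [CommRing A]

theorem substWord_none_cons (x : NCSeries N K A) (v u : Word N K) :
    substWord x (none :: v) (none :: u) = substWord x v u := by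
  rw [substWord, ncMul_single_cons, if_pos rfl]

theorem substWord_replicate_append {x : NCSeries N K A} (hx : ∀ u, depth u = 0 → x u = 0)
    (z : rootsOfUnity N K) (t : Word N K) (i : ℕ) (w : Word N K) :
    substWord x (some z :: t) (List.replicate i none ++ w) = ∑ j ∈ Finset.range w.length,
      rotate z x (List.replicate i none ++ w.take (j + 1)) * substWord x t (w.drop (j + 1)) :=
  ncMul_replicate_append (rotate_eq_zero hx z) _ _ _

variable [Finite (rootsOfUnity N K)]

/-- The words of bounded weight. -/
noncomputable def allWords (N : ℕ) (K : Type*) [Field K] [Finite (rootsOfUnity N K)] (M : ℕ) :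
    Finset (Word N K) :=
  (List.finite_length_le (Letter N K) M).toFinset

/-- The words of bounded weight whose first letter is not `e₀`. -/
noncomputable def headWords (N : ℕ) (K : Type*) [Field K] [Finite (rootsOfUnity N K)] (M : ℕ) :
    Finset (Word N K) :=
  ((List.finite_length_le (Letter N K) M).inter_of_left {v | ∃ z t, v = some z :: t}).toFinset

@[simp] theorem mem_allWords {M : ℕ} {v : Word N K} : v ∈ allWords N K M ↔ v.length ≤ M := by
  simp [allWords]

@[simp] theorem mem_headWords {M : ℕ} {v : Word N K} :
    v ∈ headWords N K M ↔ v.length ≤ M ∧ ∃ z t, v = some z :: t := by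
  rw [headWords, Set.Finite.mem_toFinset]
  rfl

/-- Sorts the words by first letter. The hypothesis `hF` handles the boundary, where prefixing e₀
leaves the range of summation. -/
theorem sum_allWords (F : Word N K → A) (M : ℕ) (hF : ∀ v, v.length = M → F (none :: v) = 0) :
    ∑ v ∈ allWords N K M, F v =
      F [] + ∑ v ∈ allWords N K M, F (none :: v) + ∑ v ∈ headWords N K M, F v := by
  classical
  have h1 : allWords N K M = insert [] ((((allWords N K M).filter fun v => v.length < M).map
      ⟨List.cons none, List.cons_injective⟩) ∪ headWords N K M) := by
    ext v
    rcases v with _ | ⟨_ | z, v⟩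
    · simp
    · simp
      omega
    · simp
  have h2 : ∑ v ∈ allWords N K M, F (none :: v) =
      ∑ v ∈ (allWords N K M).filter fun v => v.length < M, F (none :: v) := by
    symm
    refine Finset.sum_filter_of_ne fun v hv h => ?_
    rw [mem_allWords] at hv
    exact lt_of_le_of_ne hv fun h' => h (hF v h')
  rw [h2, h1, Finset.sum_insert (by simp), Finset.sum_union, Finset.sum_map, add_assoc, ← h1]
  · rfl
  · rw [Finset.disjoint_left]
    intro v hv hv'
    obtain ⟨u, -, rfl⟩ := Finset.mem_map.1 hv
    simp at hv'

theorem adIhara_eq_sum {x : NCSeries N K A} (hx : x [] = 0) (h : NCSeries N K A) (u : Word N K)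
    {M : ℕ} (hM : u.length ≤ M) :
    adIhara x h u = ∑ v ∈ allWords N K M, h v * substWord x v u := by
  refine finsum_eq_sum_of_support_subset _ fun v hv => ?_
  rw [Finset.mem_coe, mem_allWords]
  by_contra hlt
  refine hv ?_
  simp only
  rw [substWord_eq_zero_of_length_lt hx v u (by omega), mul_zero]

/-- Since `h` ignores a leading e₀, the word e₀v contributes at e₀u exactly what v contributes at u.
Only words with another first letter add something new, whence a telescoping sum. -/
theorem adIhara_none_cons {x : NCSeries N K A} (hx : x [] = 0) {h : NCSeries N K A}
    (hh : h ∈ drrtSpace N K A) (u : Word N K) :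
    adIhara x h (none :: u) = adIhara x h u +
      ∑ v ∈ headWords N K (u.length + 1), h v * substWord x v (none :: u) := by
  have hh' : ∀ v, h (none :: v) = h v := fun v => hh v 1
  rw [adIhara_eq_sum hx h _ (M := u.length + 1) (by simp),
    adIhara_eq_sum hx h u (M := u.length + 1) (by simp), sum_allWords]
  · simp only [hh', substWord_none_cons]
    simp [substWord, single]
  · intro v hv
    rw [substWord_none_cons, substWord_eq_zero_of_length_lt hx, mul_zero]
    omega

theorem adIhara_some_cons {x : NCSeries N K A} (hx : x [] = 0) (h : NCSeries N K A)
    (y : rootsOfUnity N K) (s : Word N K) :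
    adIhara x h (some y :: s) =
      ∑ v ∈ headWords N K (s.length + 1), h v * substWord x v (some y :: s) := by
  have h0 : ∀ v, substWord x (none :: v) (some y :: s) = 0 := fun v => by
    rw [substWord, ncMul_single_cons, if_neg (by simp)]
  rw [adIhara_eq_sum hx h _ (M := s.length + 1) (by simp), sum_allWords]
  · simp only [h0]
    simp [substWord, single]
  · simp [h0]

theorem adIhara_replicate_append {x : NCSeries N K A} (hx : ∀ u, depth u = 0 → x u = 0)
    {h : NCSeries N K A} (hh : h ∈ drrtSpace N K A) (y : rootsOfUnity N K) (s : Word N K)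
    (l : ℕ) :
    adIhara x h (List.replicate l none ++ some y :: s) =
      ∑ v ∈ headWords N K (s.length + 1), h v *
        ∑ i ∈ Finset.range (l + 1), substWord x v (List.replicate i none ++ some y :: s) := by
  have hx' : x [] = 0 := hx [] rfl
  induction l with
  | zero => simpa using adIhara_some_cons hx' h y s
  | succ l ih =>
    rw [List.replicate_succ, List.cons_append, adIhara_none_cons hx' hh, ih]
    simp only [Finset.sum_range_succ _ (l + 1), mul_add, Finset.sum_add_distrib]
    congr 1
    rw [← List.cons_append, ← List.replicate_succ]
    -- The range of `v` can be kept independent of `l`: the image of the tail `t` of `v` is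
    -- evaluated at suffixes of `s`, so it vanishes once `t` is longer than `s`.
    refine (Finset.sum_subset (fun v hv => ?_) fun v hv hv' => ?_).symm
    · rw [mem_headWords] at hv ⊢
      exact ⟨hv.1.trans (by simp; omega), hv.2⟩
    · rw [mem_headWords] at hv hv'
      obtain ⟨-, z, t, rfl⟩ := hv
      have hlt : s.length + 1 ≤ t.length := by
        by_contra hlt
        refine hv' ⟨?_, z, t, rfl⟩
        simp
        omega
      rw [substWord_replicate_append hx, Finset.sum_eq_zero, mul_zero]
      intro j hj
      rw [substWord_eq_zero_of_length_lt hx' t, mul_zero]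
      simp at hj ⊢
      omega

theorem adIhara_replicate {x : NCSeries N K A} (hx0 : ∀ u, depth u = 0 → x u = 0)
    (hx1 : ∀ u, depth u = 1 → x u = open Classical in if u = [some 1] then 1 else 0)
    {h : NCSeries N K A} (hh : h ∈ drrtSpace N K A) (l : ℕ) :
    adIhara x h (List.replicate l none) = h [] := by
  have hx' : x [] = 0 := hx0 [] rfl
  induction l with
  | zero =>
    rw [adIhara_eq_sum hx' h _ (M := 0) (by simp), Finset.sum_eq_single []]
    · simp [substWord, single]
    · intro v hv hne
      simp at hv
      exact absurd hv hne
    · simp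
  | succ l ih =>
    rw [List.replicate_succ, adIhara_none_cons hx' hh, ih, Finset.sum_eq_zero, add_zero]
    intro v hv
    obtain ⟨-, z, t, rfl⟩ := mem_headWords.1 hv
    rw [← List.replicate_succ, substWord_of_depth_le hx0 hx1, if_neg, mul_zero]
    · simp [List.replicate_succ]
    · simp [depth_replicate_none]

end FiniteSums

/-! ### Harmonic words: first and last letters distinct from e₀. -/

section HarmonicWords

variable {N : ℕ} {K : Type*} [Field K] {A : Type*} [CommRing A]

theorem eq_replicate_or_eq_replicate_append (w : Word N K) :
    ∃ k, w = List.replicate k none ∨ ∃ y s, w = List.replicate k none ++ some y :: s := by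
  induction w with
  | nil => exact ⟨0, Or.inl rfl⟩
  | cons a w ih =>
    cases a with
    | some y => exact ⟨0, Or.inr ⟨y, w, rfl⟩⟩
    | none =>
      obtain ⟨k, h | ⟨y, s, h⟩⟩ := ih
      · exact ⟨k + 1, Or.inl (by rw [h, List.replicate_succ])⟩
      · exact ⟨k + 1, Or.inr ⟨y, s, by rw [h, List.replicate_succ, List.cons_append]⟩⟩

/-- Cut after each letter other than e₀; a block with `k` letters e₀ has exponent `k + 1`. A final
e₀ is the only obstruction. -/
theorem exists_flatMap_eq (t : Word N K) (ht : t.getLast? ≠ some none) :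
    ∃ q : List (ℕ+ × rootsOfUnity N K),
      q.flatMap (fun q => List.replicate ((q.1 : ℕ) - 1) none ++ [some q.2]) = t := by
  induction hn : t.length using Nat.strong_induction_on generalizing t with
  | _ n ih =>
    obtain ⟨k, h | ⟨y, s, h⟩⟩ := eq_replicate_or_eq_replicate_append t
    · cases k with
      | zero => exact ⟨[], by simp [h]⟩
      | succ k => exact absurd (by simp [h, List.getLast?_replicate]) ht
    · obtain ⟨q, hq⟩ := ih s.length (by rw [← hn, h]; simp; omega) s (by
        intro hs
        refine ht ?_
        rw [h, List.getLast?_append, List.getLast?_cons, hs]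
        simp) rfl
      refine ⟨(k.succPNat, y) :: q, ?_⟩
      rw [List.flatMap_cons, hq, h]
      simp

theorem exists_toWord_eq (z : rootsOfUnity N K) (t : Word N K)
    (ht : (some z :: t).getLast? ≠ some none) : ∃ q : HarWord N K, q.toWord = some z :: t := by
  obtain ⟨q, hq⟩ := exists_flatMap_eq t (by
    intro h
    rw [List.getLast?_cons, h] at ht
    simp at ht)
  exact ⟨(z, q), by rw [HarWord.toWord, hq]⟩

theorem flatMap_getLast?_ne (q : List (ℕ+ × rootsOfUnity N K)) :
    (q.flatMap (fun q => List.replicate ((q.1 : ℕ) - 1) none ++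
      [some q.2]) : Word N K).getLast? ≠ some none := by
  induction q with
  | nil => simp
  | cons a q ih =>
    rw [List.flatMap_cons, List.getLast?_append]
    cases h : (q.flatMap (fun q => List.replicate ((q.1 : ℕ) - 1) none ++
      [some q.2]) : Word N K).getLast? with
    | none => simp
    | some b =>
      rw [h] at ih
      simpa using ih

theorem toWord_getLast?_ne (w : HarWord N K) : w.toWord.getLast? ≠ some none := by
  rw [HarWord.toWord, List.getLast?_cons]
  cases h : (w.2.flatMap (fun q => List.replicate ((q.1 : ℕ) - 1) none ++
      [some q.2]) : Word N K).getLast? with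
  | none => simp
  | some b =>
    have := flatMap_getLast?_ne w.2
    rw [h] at this
    simpa using this

/-- The substitution fixes e₀, so a final e₀ stays final. Thus words ending in e₀, which are not
harmonic, do not contribute to harmonic coefficients. -/
theorem substWord_append_none (x : NCSeries N K A) (v u : Word N K)
    (hu : u.getLast? ≠ some none) : substWord x (v ++ [none]) u = 0 := by
  induction v generalizing u with
  | nil =>
    rw [List.nil_append, substWord, substWord]
    rcases u with _ | ⟨b, u⟩
    · exact ncMul_single_nil _ _
    · rw [ncMul_single_cons]
      split_ifs with h
      · rw [single, if_neg]
        rintro rfl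
        simp [h] at hu
      · rfl
  | cons a v ih =>
    cases a with
    | none =>
      rw [List.cons_append, substWord]
      rcases u with _ | ⟨b, u⟩
      · exact ncMul_single_nil _ _
      · rw [ncMul_single_cons, ih, ite_self]
        intro h
        rw [List.getLast?_cons, h] at hu
        simp at hu
    | some z =>
      rw [List.cons_append, substWord, ncMul]
      refine Finset.sum_eq_zero fun i _ => ?_
      rw [ih, mul_zero]
      rw [List.getLast?_drop]
      split_ifs <;> simp [hu]

theorem substWord_eq_zero_of_getLast? (x : NCSeries N K A) {v u : Word N K}
    (hv : v.getLast? = some none) (hu : u.getLast? ≠ some none) : substWord x v u = 0 := by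
  obtain ⟨v', rfl⟩ := List.getLast?_eq_some_iff.1 hv
  exact substWord_append_none x v' u hu

end HarmonicWords

/-! ### Existence of the limits and stability of independence. -/

section Stability

variable {N : ℕ} {K : Type*} [Field K] {A : Type*} [NormedCommRing A] {R : Subring (ℕ+ → A)}

theorem adScale_mem (hR : ∀ a : A, (fun _ => a) ∈ R) (hid : (fun n : ℕ+ => ((n : ℕ) : A)) ∈ R)
    (x : NCSeries N K A) (w : Word N K) : (fun n : ℕ+ => adScale n x w) ∈ R :=
  R.mul_mem (R.pow_mem hid (w.length - 1)) (hR (x w))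

theorem ncMul_mem {f g : ℕ+ → NCSeries N K A} (hf : ∀ w, (fun n => f n w) ∈ R)
    (hg : ∀ w, (fun n => g n w) ∈ R) (w : Word N K) : (fun n => ncMul (f n) (g n) w) ∈ R := by
  have : (fun n => ncMul (f n) (g n) w) = ∑ i ∈ Finset.range (w.length + 1),
      (fun n => f n (w.take i)) * (fun n => g n (w.drop i)) := by
    ext n
    simp [ncMul, Finset.sum_apply]
  rw [this]
  exact R.sum_mem fun i _ => R.mul_mem (hf _) (hg _)

theorem substWord_adScale_mem (hR : ∀ a : A, (fun _ => a) ∈ R)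
    (hid : (fun n : ℕ+ => ((n : ℕ) : A)) ∈ R) (x : NCSeries N K A) (v w : Word N K) :
    (fun n : ℕ+ => substWord (adScale n x) v w) ∈ R := by
  induction v generalizing w with
  | nil => exact hR _
  | cons a v ih =>
    cases a with
    | none => exact ncMul_mem (f := fun _ => single [none]) (fun w => hR _) ih w
    | some z => exact ncMul_mem (fun w => adScale_mem hR hid x _) ih w

/-- Isolates the dependence on `i`: the prefix has weight `i + j + 1`, so the scaling by n
contributes n^i n^j, and n^i makes the sum over `i` a power series in n. -/
theorem substWord_adScale_replicate_append {x : NCSeries N K A}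
    (hx : ∀ u, depth u = 0 → x u = 0) (n : ℕ) (z : rootsOfUnity N K) (t : Word N K) (i : ℕ)
    (w : Word N K) :
    substWord (adScale n x) (some z :: t) (List.replicate i none ++ w) =
      ∑ j ∈ Finset.range w.length, (x (List.replicate i none ++
        (w.take (j + 1)).map (Option.map (fun z' => z⁻¹ * z'))) * (n : A) ^ i) *
          ((n : A) ^ j * substWord (adScale n x) t (w.drop (j + 1))) := by
  rw [substWord_replicate_append (adScale_apply_depth_zero hx n)]
  refine Finset.sum_congr rfl fun j hj => ?_
  rw [Finset.mem_range] at hj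
  have h1 : (List.replicate i (none : Letter N K) ++
      (w.take (j + 1)).map (Option.map (fun z' => z⁻¹ * z'))).length - 1 = i + j := by
    simp
    omega
  rw [rotate, List.map_append, List.map_replicate, Option.map_none, adScale, h1, pow_add]
  ring

variable [IsUltrametricDist A]

theorem limSeries_mem_drrtSpace {f : NCSeries N K A} (hf : f ∈ limSpace N K A) :
    limSeries f ∈ drrtSpace N K A := by
  intro w k
  obtain ⟨a, ha⟩ := hf w
  rw [limSeries, limSeries, ha.limUnder_eq]
  refine Tendsto.limUnder_eq ((ha.comp (tendsto_add_atTop_nat k)).congr fun l => ?_)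
  rw [Function.comp_apply, ← List.append_assoc, ← List.replicate_add]

theorem tsum_substWord_adScale_mem (hR : ∀ a : A, (fun _ => a) ∈ R)
    (hid : (fun n : ℕ+ => ((n : ℕ) : A)) ∈ R) {x : NCSeries N K A}
    (hx0 : ∀ u, depth u = 0 → x u = 0)
    (hx : ∀ z w, SumsIn R (fun i => x (List.replicate i none ++ some z :: w)))
    (z : rootsOfUnity N K) (t : Word N K) (y : rootsOfUnity N K) (s : Word N K) :
    (fun n : ℕ+ => ∑' i, substWord (adScale n x) (some z :: t)
      (List.replicate i none ++ some y :: s)) ∈ R := by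
  simp only [substWord_adScale_replicate_append hx0]
  set w : Word N K := some y :: s with hw
  have h := fun j => (hx (z⁻¹ * y) ((s.take j).map (Option.map (fun z' => z⁻¹ * z')))).2
  choose f hf hs using h
  have key : (fun n : ℕ+ => ∑' i, ∑ j ∈ Finset.range w.length, (x (List.replicate i none ++
        (w.take (j + 1)).map (Option.map (fun z' => z⁻¹ * z'))) * ((n : ℕ) : A) ^ i) *
          (((n : ℕ) : A) ^ j * substWord (adScale n x) t (w.drop (j + 1)))) =
      ∑ j ∈ Finset.range w.length, f j * ((fun n : ℕ+ => ((n : ℕ) : A)) ^ j *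
        (fun n : ℕ+ => substWord (adScale n x) t (w.drop (j + 1)))) := by
    ext n
    rw [Finset.sum_apply]
    exact (hasSum_sum fun j _ => (hs j n).mul_right _).tsum_eq
  rw [key]
  exact R.sum_mem fun j _ => R.mul_mem (hf j) (R.mul_mem (R.pow_mem hid j)
    (substWord_adScale_mem hR hid x _ _))

variable [CompleteSpace A]

theorem summable_substWord_adScale {x : NCSeries N K A} (hx0 : ∀ u, depth u = 0 → x u = 0)
    (hx : ∀ z w, SumsIn R (fun i => x (List.replicate i none ++ some z :: w)))
    (n : ℕ) (z : rootsOfUnity N K) (t : Word N K) (y : rootsOfUnity N K) (s : Word N K) :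
    Summable fun i => substWord (adScale n x) (some z :: t)
      (List.replicate i none ++ some y :: s) := by
  simp only [substWord_adScale_replicate_append hx0]
  refine summable_sum fun j _ => ?_
  refine Summable.mul_right _ (summable_mul_natCast_pow ?_ n)
  exact (hx (z⁻¹ * y) _).1

variable [Finite (rootsOfUnity N K)]

theorem tendsto_adIhara_adScale {x : NCSeries N K A} (hx0 : ∀ u, depth u = 0 → x u = 0)
    (hx : ∀ z w, SumsIn R (fun i => x (List.replicate i none ++ some z :: w)))
    {h : NCSeries N K A} (hh : h ∈ drrtSpace N K A) (n : ℕ) (y : rootsOfUnity N K)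
    (s : Word N K) :
    Tendsto (fun l : ℕ => adIhara (adScale n x) h (List.replicate l none ++ some y :: s)) atTop
      (𝓝 (∑ v ∈ headWords N K (s.length + 1), h v *
        ∑' i, substWord (adScale n x) v (List.replicate i none ++ some y :: s))) := by
  simp only [adIhara_replicate_append (adScale_apply_depth_zero hx0 n) hh]
  refine tendsto_finsetSum _ fun v hv => Tendsto.const_mul _ ?_
  obtain ⟨-, z, t, rfl⟩ := mem_headWords.1 hv
  exact (summable_substWord_adScale hx0 hx n z t y s).hasSum.tendsto_sum_nat.comp
    (tendsto_add_atTop_nat 1)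

theorem adIhara_adScale_mem_limSpace {x : NCSeries N K A} (hx0 : ∀ u, depth u = 0 → x u = 0)
    (hx1 : ∀ u, depth u = 1 → x u = open Classical in if u = [some 1] then 1 else 0)
    (hx : ∀ z w, SumsIn R (fun i => x (List.replicate i none ++ some z :: w)))
    {h : NCSeries N K A} (hh : h ∈ drrtSpace N K A) (n : ℕ) :
    adIhara (adScale n x) h ∈ limSpace N K A := by
  intro w
  obtain ⟨k, rfl | ⟨y, s, rfl⟩⟩ := eq_replicate_or_eq_replicate_append w
  · refine ⟨h [], tendsto_const_nhds.congr fun l => ?_⟩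
    rw [← List.replicate_add, adIhara_replicate (adScale_apply_depth_zero hx0 n)
      (adScale_apply_depth_one hx1 n) hh]
  · refine ⟨_, ((tendsto_adIhara_adScale hx0 hx hh n y s).comp
      (tendsto_add_atTop_nat k)).congr fun l => ?_⟩
    rw [Function.comp_apply, ← List.append_assoc, ← List.replicate_add]

/-- Independence over `R` is stable under the harmonic Ihara action of the `x` whose coefficients
define elements of `R`. -/
theorem harAction_mem_independentSequences (hR : ∀ a : A, (fun _ => a) ∈ R)
    (hid : (fun n : ℕ+ => ((n : ℕ) : A)) ∈ R) {x : NCSeries N K A}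
    (hx0 : ∀ u, depth u = 0 → x u = 0)
    (hx1 : ∀ u, depth u = 1 → x u = open Classical in if u = [some 1] then 1 else 0)
    (hx : ∀ z w, SumsIn R (fun i => x (List.replicate i none ++ some z :: w)))
    {h : ℕ → NCSeries N K A} (hh : h ∈ independentSequences N K R) :
    (∀ n, adIhara (adScale n x) (h n) ∈ limSpace N K A) ∧
      harAction x h ∈ independentSequences N K R := by
  classical
  have hlim := fun n => adIhara_adScale_mem_limSpace hx0 hx1 hx (hh.1 n) n
  refine ⟨hlim, fun n => limSeries_mem_drrtSpace (hlim n), ?_⟩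
  -- The grading is the depth; the difference of the two families must come from shallower words.
  refine linearIndependent_of_triangular hh.2 (fun w => depth w.toWord) fun w => ?_
  obtain ⟨y, s, hw⟩ : ∃ y s, w.toWord = some y :: s := ⟨_, _, rfl⟩
  set S : Word N K → ℕ+ → A := fun v n =>
    ∑' i, substWord (adScale n x) v (List.replicate i none ++ some y :: s) with hS
  have hval : (fun n : ℕ+ => harAction x h n w.toWord) =
      ∑ v ∈ headWords N K (s.length + 1), S v * fun n : ℕ+ => h n v := by
    ext n
    rw [harAction, limSeries, hw, (tendsto_adIhara_adScale hx0 hx (hh.1 n) n y s).limUnder_eq,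
      Finset.sum_apply]
    exact Finset.sum_congr rfl fun v _ => mul_comm _ _
  have hle : ∀ (z : rootsOfUnity N K) (t : Word N K), depth (some y :: s) ≤ depth (some z :: t) →
      S (some z :: t) = if some z :: t = some y :: s then 1 else 0 := by
    intro z t hd
    ext n
    rw [hS]
    -- Only the leading term survives here, and a word starting with `e_z` is never e₀^i w with i >
    -- 0.
    have : ∀ i, substWord (adScale n x) (some z :: t) (List.replicate i none ++ some y :: s) =
        if i = 0 then if some z :: t = some y :: s then 1 else 0 else 0 := by
      intro i
      rw [substWord_of_depth_le (adScale_apply_depth_zero hx0 n) (adScale_apply_depth_one hx1 n)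
        _ _ (by rwa [depth_append, depth_replicate_none, zero_add])]
      cases i with
      | zero => simp [eq_comm]
      | succ i => simp [List.replicate_succ]
    simp only [this, tsum_ite_eq]
    split_ifs <;> rfl
  have hmem : some y :: s ∈ headWords N K (s.length + 1) := by simp
  rw [hval, ← Finset.add_sum_erase _ _ hmem, hle y s le_rfl, if_pos rfl, one_mul, hw,
    add_sub_cancel_left]
  refine Submodule.sum_mem _ fun v hv => ?_
  rw [Finset.mem_erase] at hv
  obtain ⟨hne, hv⟩ := hv
  obtain ⟨-, z, t, rfl⟩ := mem_headWords.1 hv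
  -- Non-harmonic `v` drop out; a harmonic `v` at least as deep as `w` and different from it has
  -- multiplier 0; the others are shallower.
  by_cases hlast : (some z :: t).getLast? = some none
  · have : S (some z :: t) = 0 := by
      ext n
      have h0 : ∀ i, substWord (adScale n x) (some z :: t)
          (List.replicate i none ++ some y :: s) = 0 := by
        intro i
        refine substWord_eq_zero_of_getLast? _ hlast ?_
        have := toWord_getLast?_ne w
        rw [hw] at this
        rw [List.getLast?_append_of_ne_nil _ (by simp)]
        exact this
      simp [hS, h0]
    rw [this, zero_mul]
    exact Submodule.zero_mem _
  · obtain ⟨q, hq⟩ := exists_toWord_eq z t hlast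
    by_cases hd : depth (some y :: s) ≤ depth (some z :: t)
    · rw [hle z t hd, if_neg hne, zero_mul]
      exact Submodule.zero_mem _
    · have hSR : S (some z :: t) ∈ R := tsum_substWord_adScale_mem hR hid hx0 hx z t y s
      have := Submodule.smul_mem (Submodule.span R
        ((fun (w : HarWord N K) (n : ℕ+) => h n w.toWord) ''
          {j | depth j.toWord < depth (some y :: s)})) (⟨_, hSR⟩ : R)
        (Submodule.subset_span ⟨q, by simpa [hq] using hd, rfl⟩)
      simpa only [Subring.smul_def, hq, smul_eq_mul] using this

end Stability

/-! ### Power series converging on the closed unit ball. -/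

section Tate

variable {L : Type*} [NontriviallyNormedField L]

/-- Functions given on the closed unit ball by a power series which converges there. -/
def IsTate (f : L → L) : Prop :=
  ∃ a : ℕ → L, Tendsto a atTop (𝓝 0) ∧ ∀ x : L, ‖x‖ ≤ 1 → HasSum (fun k => a k * x ^ k) (f x)

theorem isTate_const (c : L) : IsTate (fun _ => c) := by
  refine ⟨fun k => if k = 0 then c else 0, tendsto_const_nhds.congr' ?_, fun x _ => ?_⟩
  · filter_upwards [eventually_gt_atTop 0] with i hi
    simp [hi.ne']
  · convert hasSum_ite_eq (0 : ℕ) c using 2 with i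
    split_ifs with h <;> simp [h]

theorem isTate_id : IsTate (fun x : L => x) := by
  refine ⟨fun k => if k = 1 then 1 else 0, tendsto_const_nhds.congr' ?_, fun x _ => ?_⟩
  · filter_upwards [eventually_gt_atTop 1] with i hi
    simp [hi.ne']
  · convert hasSum_ite_eq (1 : ℕ) x using 2 with i
    split_ifs with h <;> simp [h]

theorem IsTate.add {f g : L → L} (hf : IsTate f) (hg : IsTate g) :
    IsTate (fun x => f x + g x) := by
  obtain ⟨a, ha, hf⟩ := hf
  obtain ⟨b, hb, hg⟩ := hg
  refine ⟨fun k => a k + b k, by simpa using ha.add hb, fun x hx => ?_⟩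
  simpa [add_mul] using (hf x hx).add (hg x hx)

theorem hasFPowerSeriesAt_ofScalars {f : L → L} {a : ℕ → L} (ha : Tendsto a atTop (𝓝 0))
    (hf : ∀ x : L, ‖x‖ ≤ 1 → HasSum (fun k => a k * x ^ k) (f x)) :
    HasFPowerSeriesAt f (FormalMultilinearSeries.ofScalars L a) 0 := by
  refine ⟨1, ?_, one_pos, ?_⟩
  · refine FormalMultilinearSeries.le_radius_of_tendsto _ (l := 0) (r := 1) ?_
    simpa [FormalMultilinearSeries.ofScalars_norm] using
      tendsto_zero_iff_norm_tendsto_zero.1 ha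
  · intro y hy
    have hy' : ‖y‖ ≤ 1 := by
      have h := (Metric.mem_eball.1 hy).le
      rw [edist_zero_right, ← enorm_one (G := L), enorm_le_iff_norm_le, norm_one] at h
      exact h
    simpa [FormalMultilinearSeries.ofScalars_apply_eq, mul_comm] using hf y hy'

variable [IsUltrametricDist L]

theorem IsTate.mul {f g : L → L} (hf : IsTate f) (hg : IsTate g) :
    IsTate (fun x => f x * g x) := by
  obtain ⟨a, ha, hf⟩ := hf
  obtain ⟨b, hb, hg⟩ := hg
  have hs : ∀ x : L, ‖x‖ ≤ 1 →
      HasSum (fun k => (∑ q ∈ Finset.HasAntidiagonal.antidiagonal k, a q.1 * b q.2) * x ^ k)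
        (f x * g x) := by
    intro x hx
    have : NonarchimedeanRing L :=
      { is_nonarchimedean := NonarchimedeanAddGroup.is_nonarchimedean (G := L) }
    have h := (hf x hx).mul_of_nonarchimedean (hg x hx)
    rw [← Finset.HasAntidiagonal.sigmaAntidiagonalEquivProd.hasSum_iff] at h
    convert h.sigma (fun k => hasSum_fintype _) using 2 with k
    rw [Finset.sum_mul, ← Finset.sum_coe_sort]
    refine Finset.sum_congr rfl fun q _ => ?_
    have hq : (q : ℕ × ℕ).1 + (q : ℕ × ℕ).2 = k :=
      Finset.HasAntidiagonal.mem_antidiagonal.1 q.2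
    simp only [Function.comp_apply, Finset.HasAntidiagonal.sigmaAntidiagonalEquivProd_apply]
    rw [show x ^ k = x ^ (q : ℕ × ℕ).1 * x ^ (q : ℕ × ℕ).2 by rw [← pow_add, hq]]
    ring
  -- The coefficients tend to 0 because the series converges at x = 1.
  exact ⟨_, by simpa using (hs 1 (by simp)).summable.tendsto_atTop_zero, hs⟩

theorem norm_natCast_le_one' (n : ℕ) : ‖(n : L)‖ ≤ 1 := IsUltrametricDist.norm_natCast_le_one L n

theorem norm_intCast_le_one' (n : ℤ) : ‖(n : L)‖ ≤ 1 := IsUltrametricDist.norm_intCast_le_one L n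

variable [CompleteSpace L]

theorem isTate_tsum {a : ℕ → L} (ha : Tendsto a atTop (𝓝 0)) :
    IsTate (fun x => ∑' k, a k * x ^ k) := by
  refine ⟨a, ha, fun x hx => Summable.hasSum ?_⟩
  rw [NonarchimedeanAddGroup.summable_iff_tendsto_cofinite_zero, Nat.cofinite_eq_atTop]
  refine squeeze_zero_norm (fun k => ?_) (tendsto_zero_iff_norm_tendsto_zero.1 ha)
  rw [norm_mul, norm_pow]
  exact mul_le_of_le_one_right (norm_nonneg _) (pow_le_one₀ (norm_nonneg _) hx)

/-- Translations by elements of the closed unit ball preserve the power series which converge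
there. -/
theorem IsTate.translate {f : L → L} (hf : IsTate f) {c : L} (hc : ‖c‖ ≤ 1) :
    IsTate (fun x => f (x + c)) := by
  obtain ⟨a, ha, hf⟩ := hf
  -- Binomial expansion of ∑ a_k (x+c)^k, indexed by (j, k). It is bounded by |a_k| and zero for j >
  -- k, hence summable; summing over j identifies the value, summing over k gives the new
  -- coefficients.
  let u : L → ℕ × ℕ → L := fun x q => a q.2 * (x ^ q.1 * c ^ (q.2 - q.1) * (q.2.choose q.1 : L))
  have hle : ∀ x, ‖x‖ ≤ 1 → ∀ q, ‖u x q‖ ≤ ‖a q.2‖ := by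
    intro x hx q
    simp only [u, norm_mul, norm_pow]
    refine mul_le_of_le_one_right (norm_nonneg _) ?_
    refine mul_le_one₀ (mul_le_one₀ (pow_le_one₀ (norm_nonneg _) hx) (by positivity)
      (pow_le_one₀ (norm_nonneg _) hc)) (norm_nonneg _) (norm_natCast_le_one' _)
  have hsum : ∀ x, ‖x‖ ≤ 1 → Summable (u x) := by
    intro x hx
    rw [NonarchimedeanAddGroup.summable_iff_tendsto_cofinite_zero, Metric.tendsto_nhds]
    intro ε hε
    obtain ⟨M, hM⟩ := (Metric.tendsto_atTop.1 ha) ε hε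
    rw [eventually_cofinite]
    refine ((Finset.range M ×ˢ Finset.range M).finite_toSet).subset fun q hq => ?_
    rw [Set.mem_ofPred_eq, dist_zero_right, not_lt] at hq
    have h2 : q.2 < M := by
      by_contra h
      have := hM q.2 (not_lt.1 h)
      rw [dist_zero_right] at this
      exact absurd (hq.trans (hle x hx q)) (not_le.2 this)
    have h1 : q.1 ≤ q.2 := by
      by_contra h
      simp only [u, Nat.choose_eq_zero_of_lt (not_le.1 h)] at hq
      simp at hq
      linarith
    simp
    omega
  have hfib : ∀ x, ‖x‖ ≤ 1 → HasSum (u x) (f (x + c)) := by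
    intro x hx
    have h1 := ((Equiv.prodComm ℕ ℕ).hasSum_iff.2 (hsum x hx).hasSum)
    have h2 : ∀ k, HasSum (fun j => (u x ∘ Equiv.prodComm ℕ ℕ) (k, j)) (a k * (x + c) ^ k) := by
      intro k
      rw [add_pow, Finset.mul_sum]
      refine hasSum_sum_of_ne_finset_zero fun j hj => ?_
      simp at hj
      simp [u, Nat.choose_eq_zero_of_lt hj]
    have h3 := h1.prod_fiberwise h2
    have h4 := hf (x + c) ((IsUltrametricDist.norm_add_le_max _ _).trans (max_le hx hc))
    rw [← h3.unique h4]
    exact (hsum x hx).hasSum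
  have hs : ∀ x, ‖x‖ ≤ 1 → HasSum (fun j => (∑' k, a k * (c ^ (k - j) * (k.choose j : L))) * x ^ j)
      (f (x + c)) := by
    intro x hx
    have h1 : Summable (u 1) := hsum 1 (by simp)
    refine (hfib x hx).prod_fiberwise fun j => ?_
    have h2 : Summable fun k => a k * (c ^ (k - j) * (k.choose j : L)) := by
      simpa [u] using h1.prod_factor j
    have h3 : (fun k => u x (j, k)) =
        fun k => a k * (c ^ (k - j) * (k.choose j : L)) * x ^ j := by
      funext k
      simp only [u]
      ring
    rw [h3]
    exact h2.hasSum.mul_right (x ^ j)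
  exact ⟨_, by simpa using (hs 1 (by simp)).summable.tendsto_atTop_zero, hs⟩

theorem IsTate.analyticAt {f : L → L} (hf : IsTate f) {c : L} (hc : ‖c‖ ≤ 1) :
    AnalyticAt L f c := by
  obtain ⟨b, hb, h⟩ := hf.translate hc
  have h0 : AnalyticAt L (fun x => f (x + c)) 0 := ⟨_, hasFPowerSeriesAt_ofScalars hb h⟩
  have h1 : AnalyticAt L (fun x : L => x - c) c := by fun_prop
  have h2 := AnalyticAt.fun_comp (g := fun x => f (x + c)) (f := fun x : L => x - c) (x := c)
    (by simpa using h0) h1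
  simpa using h2

/-- A power series which converges on the closed unit ball of a locally compact field and has
infinitely many zeros there vanishes. -/
theorem IsTate.eq_zero_of_infinite [ProperSpace L] {f : L → L} (hf : IsTate f) {Z : Set L}
    (hZ : Z.Infinite) (hZ1 : ∀ x ∈ Z, ‖x‖ ≤ 1) (hZ0 : ∀ x ∈ Z, f x = 0) (x : L) (hx : ‖x‖ ≤ 1) :
    f x = 0 := by
  obtain ⟨c, hc, hacc⟩ := hZ.exists_accPt_of_subset_isCompact (isCompact_closedBall (0 : L) 1)
    (fun x hx => by simpa using hZ1 x hx)
  have hc : ‖c‖ ≤ 1 := by simpa using hc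
  have hev : ∀ᶠ y in 𝓝 c, f y = 0 := by
    rw [← (hf.analyticAt hc).frequently_zero_iff_eventually_zero]
    exact (accPt_iff_frequently_nhdsNE.1 hacc).mono fun y hy => hZ0 y hy
  -- An ultrametric unit ball is centred at each of its points, so the expansion at `c` represents
  -- `f` on the whole ball and local vanishing is global.
  obtain ⟨b, hb, h⟩ := hf.translate hc
  have hev' : ∀ᶠ y in 𝓝 (0 : L), f (y + c) = 0 := by
    have : Tendsto (fun y : L => y + c) (𝓝 0) (𝓝 c) := by
      have h : Continuous fun y : L => y + c := by fun_prop
      simpa using h.tendsto 0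
    exact this.eventually hev
  have hb0 := (hasFPowerSeriesAt_ofScalars hb h).eq_zero_of_eventually hev'
  rw [FormalMultilinearSeries.ofScalars_series_eq_zero] at hb0
  have h1 := h (x - c) (by
    rw [sub_eq_add_neg]
    exact (IsUltrametricDist.norm_add_le_max _ _).trans (max_le hx (by rwa [norm_neg])))
  simp only [hb0, sub_add_cancel] at h1
  exact h1.unique (by simp)

end Tate

/-! ### The field of germs of quotients. -/

section Quotients

variable {L : Type*} [NontriviallyNormedField L]

variable (L) in
/-- Functions of the natural numbers that are eventually equal to a quotient of power series
which converge on the closed unit ball. -/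
def tateQuotients : Set (ℕ → L) :=
  {g | ∃ f h : L → L, IsTate f ∧ IsTate h ∧ (∀ᶠ n : ℕ in atTop, h n ≠ 0) ∧
    ∀ᶠ n : ℕ in atTop, g n = f n / h n}

theorem IsTate.mem_tateQuotients {f : L → L} (hf : IsTate f) :
    (fun n : ℕ => f n) ∈ tateQuotients L :=
  ⟨f, fun _ => 1, hf, isTate_const 1, by simp, by simp⟩

theorem const_mem_tateQuotients (c : L) : (fun _ => c) ∈ tateQuotients L :=
  (isTate_const c).mem_tateQuotients

theorem natCast_mem_tateQuotients : (fun n : ℕ => (n : L)) ∈ tateQuotients L :=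
  isTate_id.mem_tateQuotients

variable [IsUltrametricDist L]

theorem add_mem_tateQuotients {g k : ℕ → L} (hg : g ∈ tateQuotients L)
    (hk : k ∈ tateQuotients L) : (fun n => g n + k n) ∈ tateQuotients L := by
  obtain ⟨f, h, hf, hh, h0, hg⟩ := hg
  obtain ⟨f', h', hf', hh', h0', hk⟩ := hk
  refine ⟨_, _, (hf.mul hh').add (hh.mul hf'), hh.mul hh', ?_, ?_⟩
  · filter_upwards [h0, h0'] with n h1 h2 using mul_ne_zero h1 h2
  · filter_upwards [h0, h0', hg, hk] with n h1 h2 h3 h4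
    rw [h3, h4, div_add_div _ _ h1 h2]

theorem mul_mem_tateQuotients {g k : ℕ → L} (hg : g ∈ tateQuotients L)
    (hk : k ∈ tateQuotients L) : (fun n => g n * k n) ∈ tateQuotients L := by
  obtain ⟨f, h, hf, hh, h0, hg⟩ := hg
  obtain ⟨f', h', hf', hh', h0', hk⟩ := hk
  refine ⟨_, _, hf.mul hf', hh.mul hh', ?_, ?_⟩
  · filter_upwards [h0, h0'] with n h1 h2 using mul_ne_zero h1 h2
  · filter_upwards [hg, hk] with n h3 h4
    rw [h3, h4, div_mul_div_comm]

theorem sub_mem_tateQuotients {g k : ℕ → L} (hg : g ∈ tateQuotients L)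
    (hk : k ∈ tateQuotients L) : (fun n => g n - k n) ∈ tateQuotients L := by
  simpa [sub_eq_add_neg] using
    add_mem_tateQuotients hg (mul_mem_tateQuotients (const_mem_tateQuotients (-1)) hk)

theorem sum_mem_tateQuotients {ι : Type*} (s : Finset ι) {g : ι → ℕ → L}
    (hg : ∀ i ∈ s, g i ∈ tateQuotients L) : (fun n => ∑ i ∈ s, g i n) ∈ tateQuotients L := by
  classical
  induction s using Finset.induction_on with
  | empty => simpa using const_mem_tateQuotients (0 : L)
  | insert i s hi ih =>
    simp only [Finset.sum_insert hi]
    exact add_mem_tateQuotients (hg i (Finset.mem_insert_self _ _))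
      (ih fun j hj => hg j (Finset.mem_insert_of_mem hj))

variable [ProperSpace L]

theorem shift_mem_tateQuotients {g : ℕ → L} (hg : g ∈ tateQuotients L) :
    (fun n => g (n + 1)) ∈ tateQuotients L := by
  obtain ⟨f, h, hf, hh, h0, hg⟩ := hg
  refine ⟨_, _, hf.translate (c := 1) (by simp), hh.translate (c := 1) (by simp), ?_, ?_⟩
  · simpa using (tendsto_add_atTop_nat 1).eventually h0
  · simpa using (tendsto_add_atTop_nat 1).eventually hg

variable [CharZero L]

/-- In characteristic 0 the natural numbers are infinitely many points of the unit ball, so a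
nonzero series vanishes at only finitely many of them. -/
theorem IsTate.eq_zero_or_eventually_ne {f : L → L} (hf : IsTate f) :
    (∀ x, ‖x‖ ≤ 1 → f x = 0) ∨ ∀ᶠ n : ℕ in atTop, f n ≠ 0 := by
  rw [or_iff_not_imp_right]
  intro h x hx
  have hinf : {n : ℕ | f n = 0}.Infinite := by
    rw [← Nat.frequently_atTop_iff_infinite]
    simpa [Filter.Frequently] using h
  refine hf.eq_zero_of_infinite (hinf.image Nat.cast_injective.injOn) ?_ ?_ x hx
  · rintro _ ⟨n, -, rfl⟩
    exact norm_natCast_le_one' n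
  · rintro _ ⟨n, hn, rfl⟩
    exact hn

theorem eventually_eq_zero_or_ne {g : ℕ → L} (hg : g ∈ tateQuotients L) :
    (∀ᶠ n in atTop, g n = 0) ∨ ∀ᶠ n in atTop, g n ≠ 0 := by
  obtain ⟨f, h, hf, -, h0, hg⟩ := hg
  rcases hf.eq_zero_or_eventually_ne with hz | hz
  · left
    filter_upwards [hg] with n hn
    rw [hn, hz _ (norm_natCast_le_one' n), zero_div]
  · right
    filter_upwards [hg, hz, h0] with n hn h1 h2
    rw [hn]
    exact div_ne_zero h1 h2

/-- Germs at infinity thus form a field, which permits dividing a relation by one of its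
coefficients. -/
theorem inv_mem_tateQuotients {g : ℕ → L} (hg : g ∈ tateQuotients L) :
    (fun n => (g n)⁻¹) ∈ tateQuotients L := by
  rcases eventually_eq_zero_or_ne hg with hz | hz
  · refine ⟨_, _, isTate_const 0, isTate_const 1, by simp, ?_⟩
    filter_upwards [hz] with n hn
    simp [hn]
  · obtain ⟨f, h, hf, hh, h0, hg⟩ := hg
    refine ⟨h, f, hh, hf, ?_, ?_⟩
    · filter_upwards [hz, hg] with n h1 h2 h3
      rw [h2, h3, zero_div] at h1
      exact h1 rfl
    · filter_upwards [hg] with n hn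
      rw [hn, inv_div]

theorem inv_pow_mem_tateQuotients (s : ℕ) :
    (fun n : ℕ => ((n : L) ^ s)⁻¹) ∈ tateQuotients L := by
  refine inv_mem_tateQuotients ?_
  induction s with
  | zero => simpa using const_mem_tateQuotients (1 : L)
  | succ s ih => simpa only [pow_succ] using mul_mem_tateQuotients ih natCast_mem_tateQuotients

/-- A quotient of convergent power series which is an eigenvector of the translation, for a root
of unity, is constant. -/
theorem eventually_eq_const_of_shift {g : ℕ → L} (hg : g ∈ tateQuotients L) {c : L} {N : ℕ}
    (hN : 0 < N) (hc : c ^ N = 1) (h : ∀ᶠ n in atTop, g (n + 1) = c * g n) :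
    (∀ᶠ n in atTop, g n = 0) ∨ (c = 1 ∧ ∃ C, ∀ᶠ n in atTop, g n = C) := by
  obtain ⟨f, k, hf, hk, h0, hg⟩ := hg
  obtain ⟨m, hm⟩ := eventually_atTop.1 (h.and (h0.and hg))
  have hper : ∀ j, g (m + j) = c ^ j * g m := by
    intro j
    induction j with
    | zero => simp
    | succ j ih => rw [← add_assoc, (hm (m + j) (by omega)).1, ih, pow_succ]; ring
  -- As c^N = 1, `g` takes the value `g m` at all m + Nj; hence f − g(m) k has infinitely many
  -- zeros.
  have hF : IsTate fun x => f x + (-g m) * k x := hf.add ((isTate_const (-g m)).mul hk)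
  have hz : ∀ x, ‖x‖ ≤ 1 → f x + (-g m) * k x = 0 := by
    rcases hF.eq_zero_or_eventually_ne with hz | hz
    · exact hz
    · obtain ⟨M, hM⟩ := eventually_atTop.1 hz
      refine absurd ?_ (hM (m + N * M) (by nlinarith))
      obtain ⟨-, h1, h2⟩ := hm (m + N * M) (by omega)
      rw [hper, pow_mul, hc, one_pow, one_mul, eq_div_iff h1] at h2
      rw [← h2]
      ring
  have hconst : ∀ n, m ≤ n → g n = g m := by
    intro n hn
    obtain ⟨-, h1, h2⟩ := hm n hn
    rw [h2, div_eq_iff h1]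
    linear_combination hz n (norm_natCast_le_one' n)
  by_cases hgm : g m = 0
  · left
    filter_upwards [eventually_ge_atTop m] with n hn
    rw [hconst n hn, hgm]
  · right
    refine ⟨?_, g m, ?_⟩
    · have h1 := (hm m le_rfl).1
      rw [hconst (m + 1) (by omega)] at h1
      exact mul_right_cancel₀ hgm (by rw [one_mul]; exact h1.symm)
    · filter_upwards [eventually_ge_atTop m] with n hn using hconst n hn

end Quotients

/-! ### Poles at integers and the equation g(n) − c g(n+1) = Q(1/n). -/

section Poles

variable {L : Type*} [NontriviallyNormedField L]

variable (L) in
/-- The large natural numbers which are close, in `L`, to the integer `m`. -/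
def nearInt (m : ℤ) : Filter ℕ := atTop ⊓ comap (fun n : ℕ => (n : L)) (𝓝 (m : L))

theorem tendsto_nearInt (m : ℤ) : Tendsto (fun n : ℕ => (n : L)) (nearInt L m) (𝓝 (m : L)) :=
  tendsto_comap.mono_left inf_le_right

theorem nearInt_le_atTop (m : ℤ) : nearInt L m ≤ atTop := inf_le_left

theorem tendsto_add_one_nearInt (m : ℤ) :
    Tendsto (fun n => n + 1) (nearInt L m) (nearInt L (m + 1)) := by
  refine tendsto_inf.2 ⟨(tendsto_add_atTop_nat 1).mono_left (nearInt_le_atTop m),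
    tendsto_comap_iff.2 ?_⟩
  simpa [Function.comp_def] using (tendsto_nearInt (L := L) m).add_const 1

theorem tendsto_sub_one_nearInt (m : ℤ) :
    Tendsto (fun n => n - 1) (nearInt L (m + 1)) (nearInt L m) := by
  refine tendsto_inf.2 ⟨(tendsto_sub_atTop_nat 1).mono_left (nearInt_le_atTop _),
    tendsto_comap_iff.2 ?_⟩
  have h := (tendsto_nearInt (L := L) (m + 1)).sub_const 1
  simp only [Int.cast_add, Int.cast_one, add_sub_cancel_right] at h
  refine h.congr' ?_
  filter_upwards [nearInt_le_atTop (m + 1) (eventually_ge_atTop 1)] with n hn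
  simp [Nat.cast_sub hn]

variable (L) in
/-- `g` is bounded near the integer `m`. -/
def BoundedNear (g : ℕ → L) (m : ℤ) : Prop := g =O[nearInt L m] (fun _ => (1 : ℝ))

theorem boundedNear_shift {g : ℕ → L} {m : ℤ} :
    BoundedNear L (fun n => g (n + 1)) m ↔ BoundedNear L g (m + 1) := by
  constructor
  · intro h
    refine (h.comp_tendsto (tendsto_sub_one_nearInt m)).congr' ?_ EventuallyEq.rfl
    filter_upwards [nearInt_le_atTop (m + 1) (eventually_ge_atTop 1)] with n hn
    simp [Nat.sub_add_cancel hn]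
  · intro h
    exact h.comp_tendsto (tendsto_add_one_nearInt m)

theorem BoundedNear.congr {g k : ℕ → L} {m : ℤ} (h : BoundedNear L g m)
    (hgk : ∀ᶠ n in atTop, g n = k n) : BoundedNear L k m :=
  h.congr' (nearInt_le_atTop m hgk) EventuallyEq.rfl

/-- The integers m + p^k (1 + |m|) tend to m p-adically; the factor 1 + |m| makes them at least k,
hence natural and arbitrarily large. -/
theorem nearInt_neBot (p : ℕ) [Fact p.Prime] [NormedAlgebra ℚ_[p] L] (m : ℤ) :
    (nearInt L m).NeBot := by
  have hpos : ∀ k : ℕ, (k : ℤ) ≤ m + p ^ k * (1 + m.natAbs) := by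
    intro k
    have h1 : k < p ^ k := Nat.lt_pow_self (Fact.out : p.Prime).one_lt
    have h2 : (k : ℤ) < (p : ℤ) ^ k := by exact_mod_cast h1
    have h3 : -m ≤ m.natAbs := by omega
    nlinarith [mul_le_mul_of_nonneg_right (show (1 : ℤ) ≤ (p : ℤ) ^ k by omega)
      (Int.natCast_nonneg m.natAbs)]
  have hp : ‖(p : L)‖ < 1 := by
    rw [← map_natCast (algebraMap ℚ_[p] L), norm_algebraMap']
    exact Padic.norm_p_lt_one
  have h : Tendsto (fun k : ℕ => (m + p ^ k * (1 + m.natAbs) : ℤ).toNat) atTop (nearInt L m) := by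
    refine tendsto_inf.2 ⟨tendsto_atTop_mono (fun k => ?_) tendsto_id, tendsto_comap_iff.2 ?_⟩
    · have := hpos k
      simp only [id]
      omega
    · have h1 : ∀ k : ℕ, (((m + p ^ k * (1 + m.natAbs) : ℤ).toNat : ℕ) : L) =
          m + (p : L) ^ k * (1 + (m.natAbs : L)) := by
        intro k
        have h2 : (((m + p ^ k * (1 + m.natAbs) : ℤ).toNat : ℤ)) =
            m + p ^ k * (1 + m.natAbs) := Int.toNat_of_nonneg (by have := hpos k; omega)
        have h3 := congrArg (Int.cast : ℤ → L) h2
        rw [Int.cast_natCast] at h3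
        rw [h3]
        push_cast
        rw [Nat.cast_natAbs]
      simp only [Function.comp_def, h1]
      simpa using ((tendsto_pow_atTop_nhds_zero_of_norm_lt_one hp).mul_const
        (1 + (m.natAbs : L))).const_add (m : L)
  exact h.neBot

theorem boundedNear_polynomial_inv [CharZero L] (Q : Polynomial L) {m : ℤ} (hm : m ≠ 0) :
    BoundedNear L (fun n => Q.eval (n : L)⁻¹) m := by
  have h := (tendsto_nearInt (L := L) m).inv₀ (Int.cast_ne_zero.2 hm)
  exact ((Q.continuous.tendsto _).comp h).isBigO_one ℝ

theorem not_boundedNear_polynomial_inv {Q : Polynomial L} (hQ : 0 < Q.degree)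
    [CharZero L] [(nearInt L 0).NeBot] : ¬ BoundedNear L (fun n => Q.eval (n : L)⁻¹) 0 := by
  intro h
  have h1 : Tendsto (fun n : ℕ => (n : L)) (nearInt L 0) (𝓝[≠] 0) := by
    refine tendsto_nhdsWithin_iff.2 ⟨by simpa using tendsto_nearInt (L := L) 0, ?_⟩
    filter_upwards [nearInt_le_atTop 0 (eventually_ge_atTop 1)] with n hn
    simp
    omega
  have h2 := Q.tendsto_norm_atTop hQ (tendsto_norm_inv_nhdsNE_zero_atTop.comp h1)
  obtain ⟨B, hB⟩ := h.bound
  obtain ⟨n, hn1, hn2⟩ := (hB.and (h2.eventually_gt_atTop B)).exists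
  simp at hn1
  exact absurd hn1 (not_le.2 hn2)

variable [IsUltrametricDist L] [ProperSpace L]

/-- Read contrapositively: where `g` is unbounded near an integer, the denominator vanishes. -/
theorem boundedNear_of_ne_zero {g : ℕ → L} {f h : L → L} (hf : IsTate f) (hh : IsTate h)
    (hg : ∀ᶠ n : ℕ in atTop, g n = f n / h n) {m : ℤ} (hm : h m ≠ 0) : BoundedNear L g m := by
  have h1 := (hf.analyticAt (norm_intCast_le_one' m)).continuousAt
  have h2 := (hh.analyticAt (norm_intCast_le_one' m)).continuousAt
  have h3 := ((h1.div h2 hm).tendsto.comp (tendsto_nearInt m)).isBigO_one ℝ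
  exact BoundedNear.congr h3 (hg.mono fun n hn => hn.symm)

variable [CharZero L]

/-- A polynomial of positive degree in `1 / n` is not of the form `g n - c * g (n + 1)`, where `g`
is a quotient of convergent power series. -/
theorem not_eventually_sub_shift_eq {g : ℕ → L} (hg : g ∈ tateQuotients L) {c : L} (hc : c ≠ 0)
    {Q : Polynomial L} (hQ : 0 < Q.degree) [(nearInt L 0).NeBot]
    (h : ∀ᶠ n : ℕ in atTop, g n - c * g (n + 1) = Q.eval (n : L)⁻¹) : False := by
  obtain ⟨f, k, hf, hk, h0, hg⟩ := hg
  -- Infinitely many poles would force the denominator to be identically zero.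
  have hfin : ∀ e : ℕ → ℤ, Function.Injective e → ¬ ∀ j, ¬ BoundedNear L g (e j) := by
    intro e he hb
    have hz : ∀ j, k (e j) = 0 := by
      intro j
      by_contra hne
      exact hb j (boundedNear_of_ne_zero hf hk hg hne)
    have hz' := hk.eq_zero_of_infinite (Z := Set.range fun j => ((e j : ℤ) : L))
      (Set.infinite_range_of_injective (Int.cast_injective.comp he))
      (by rintro _ ⟨j, rfl⟩; exact norm_intCast_le_one' _) (by rintro _ ⟨j, rfl⟩; exact hz j)
    obtain ⟨n, hn⟩ := h0.exists
    exact hn (hz' _ (norm_natCast_le_one' n))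
  -- Away from 0 the right-hand side is bounded, so the equation carries boundedness between m and m
  -- + 1. A pole at 1 would spread to all positive integers, and one at 0 to all negative ones.
  have hup : ∀ m : ℤ, m ≠ 0 → BoundedNear L g (m + 1) → BoundedNear L g m := by
    intro m hm hb
    have h1 := (boundedNear_polynomial_inv Q hm).add ((boundedNear_shift.2 hb).const_mul_left c)
    exact BoundedNear.congr h1 (h.mono fun n hn => by rw [← hn]; ring)
  have hdown : ∀ m : ℤ, m ≠ 0 → BoundedNear L g m → BoundedNear L g (m + 1) := by
    intro m hm hb
    have h1 := ((boundedNear_polynomial_inv Q hm).sub hb).const_mul_left (-c⁻¹)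
    refine boundedNear_shift.1 (BoundedNear.congr h1 (h.mono fun n hn => ?_))
    rw [← hn]
    field_simp
    ring
  have h1 : ∀ j : ℕ, ¬ BoundedNear L g 1 → ¬ BoundedNear L g ((j : ℤ) + 1) := by
    intro j hj
    induction j with
    | zero => simpa using hj
    | succ j ih => exact fun hb => ih (hup _ (by omega) (by simpa using hb))
  have h2 : ∀ j : ℕ, ¬ BoundedNear L g 0 → ¬ BoundedNear L g (-(j : ℤ)) := by
    intro j hj
    induction j with
    | zero => simpa using hj
    | succ j ih =>
      intro hb
      refine ih ?_
      have := hdown _ (by omega) hb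
      rwa [show -((j + 1 : ℕ) : ℤ) + 1 = -(j : ℤ) by push_cast; ring] at this
  have hb1 : BoundedNear L g 1 := by
    by_contra hb
    exact hfin (fun j => (j : ℤ) + 1) (fun a b h => by simpa using h) fun j => h1 j hb
  have hb0 : BoundedNear L g 0 := by
    by_contra hb
    exact hfin (fun j => -(j : ℤ)) (fun a b h => by simpa using h) fun j => h2 j hb
  refine not_boundedNear_polynomial_inv hQ ?_
  have hb1' : BoundedNear L (fun n => g (n + 1)) 0 := boundedNear_shift.2 (by simpa using hb1)
  have h3 := hb0.sub (Asymptotics.IsBigO.const_mul_left hb1' c)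
  exact BoundedNear.congr h3 h

end Poles

/-! ### Independence of iterated sums over quotients. -/

section Independence

variable {Z : Type*}

/-- The exponent of the outermost summation index of an iterated sum. -/
def headExponent : Z × List (ℕ+ × Z) → ℕ
  -- A default: the sum over `tailWord` is empty here. A positive value keeps `headExponent_pos`
  -- free of exceptions.
  | (_, []) => 1
  | (_, q :: _) => q.1

/-- The index of the inner iterated sum, if there is one. -/
def tailWord : Z × List (ℕ+ × Z) → Finset (Z × List (ℕ+ × Z))
  | (_, []) => ∅
  | (_, q :: t) => {(q.2, t)}

theorem headExponent_pos (w : Z × List (ℕ+ × Z)) : 0 < headExponent w := by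
  rcases w with ⟨z, _ | ⟨q, t⟩⟩
  · exact one_pos
  · exact q.1.pos

theorem length_of_mem_tailWord {v w : Z × List (ℕ+ × Z)} (h : v ∈ tailWord w) :
    w.2.length = v.2.length + 1 := by
  rcases w with ⟨z, _ | ⟨q, t⟩⟩
  · simp [tailWord] at h
  · simp [tailWord] at h
    simp [h]

theorem eq_of_mem_tailWord {v w w' : Z × List (ℕ+ × Z)} (h : v ∈ tailWord w)
    (h' : v ∈ tailWord w') (h1 : w.1 = w'.1) (h2 : headExponent w = headExponent w') : w = w' := by
  rcases w with ⟨z, _ | ⟨⟨s, y⟩, t⟩⟩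
  · simp [tailWord] at h
  rcases w' with ⟨z', _ | ⟨⟨s', y'⟩, t'⟩⟩
  · simp [tailWord] at h'
  simp [tailWord] at h h'
  simp [headExponent] at h1 h2
  subst h
  simp at h'
  simp [h1, h2, h'.1, h'.2]

variable {L : Type*} [NontriviallyNormedField L]

/-- The recurrence satisfied by iterated sums twisted by roots of unity. -/
def SatisfiesHarmonicRecurrence (ζ : Z → L) (H : Z × List (ℕ+ × Z) → ℕ → L) : Prop :=
  ∀ w, ∀ᶠ n : ℕ in atTop, ζ w.1 * H w (n + 1) =
    H w n + ((n : L) ^ headExponent w)⁻¹ * ∑ v ∈ tailWord w, H v n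

/-- The coefficients of the relation `F n - c * F (n + 1)`, for `F = ∑ w, g w * H w` a combination
of iterated sums. -/
def shiftedRelation [DecidableEq (Z × List (ℕ+ × Z))] (ζ : Z → L) (c : L)
    (S : Finset (Z × List (ℕ+ × Z))) (g : Z × List (ℕ+ × Z) → ℕ → L)
    (v : Z × List (ℕ+ × Z)) (n : ℕ) : L :=
  (g v n - c * (ζ v.1)⁻¹ * g v (n + 1)) -
    ∑ w ∈ S with v ∈ tailWord w, c * (ζ w.1)⁻¹ * g w (n + 1) * ((n : L) ^ headExponent w)⁻¹

/-- Subtract c times the relation at n + 1 from the relation at n, after rewriting each H_w(n+1) by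
the recurrence. The tails of words of `S` enter, so the index set grows, but only in lower depth. -/
theorem shiftedRelation_eq [DecidableEq (Z × List (ℕ+ × Z))] {ζ : Z → L} (hζ : ∀ z, ζ z ≠ 0)
    {H : Z × List (ℕ+ × Z) → ℕ → L}
    (hH : SatisfiesHarmonicRecurrence ζ H) (c : L) {S : Finset (Z × List (ℕ+ × Z))}
    {g : Z × List (ℕ+ × Z) → ℕ → L} (hg : ∀ w, w ∉ S → g w = 0)
    (hrel : ∀ᶠ n in atTop, ∑ w ∈ S, g w n * H w n = 0) :
    ∀ᶠ n in atTop, ∑ v ∈ S ∪ S.biUnion tailWord, shiftedRelation ζ c S g v n * H v n = 0 := by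
  have hH' : ∀ᶠ n : ℕ in atTop, ∀ w ∈ S, ζ w.1 * H w (n + 1) =
      H w n + ((n : L) ^ headExponent w)⁻¹ * ∑ v ∈ tailWord w, H v n :=
    (Filter.eventually_all_finset S).2 fun w _ => hH w
  filter_upwards [hH', hrel, (tendsto_add_atTop_nat 1).eventually hrel] with n h1 h2 h3
  have e1 : ∀ k : Z × List (ℕ+ × Z) → L, (∀ w, w ∉ S → k w = 0) →
      ∑ v ∈ S ∪ S.biUnion tailWord, k v = ∑ v ∈ S, k v := by
    intro k hk
    exact (Finset.sum_subset Finset.subset_union_left fun v _ hv => hk v hv).symm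
  have e2 : ∑ v ∈ S ∪ S.biUnion tailWord, (∑ w ∈ S with v ∈ tailWord w,
      c * (ζ w.1)⁻¹ * g w (n + 1) * ((n : L) ^ headExponent w)⁻¹) * H v n =
      ∑ w ∈ S, c * (ζ w.1)⁻¹ * g w (n + 1) * ((n : L) ^ headExponent w)⁻¹ *
        ∑ v ∈ tailWord w, H v n := by
    simp only [Finset.sum_mul, Finset.mul_sum]
    refine Finset.sum_comm' fun v w => ?_
    simp only [Finset.mem_union, Finset.mem_biUnion, Finset.mem_filter]
    constructor
    · tauto
    · rintro ⟨h1, h2⟩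
      exact ⟨Or.inr ⟨w, h2, h1⟩, h2, h1⟩
  simp only [shiftedRelation, sub_mul, Finset.sum_sub_distrib]
  rw [e1 _ (fun w hw => by simp [hg w hw]), e1 _ (fun w hw => by simp [hg w hw]), e2, h2]
  have e3 : ∀ w ∈ S, c * (g w (n + 1) * H w (n + 1)) =
      c * (ζ w.1)⁻¹ * g w (n + 1) * H w n +
        c * (ζ w.1)⁻¹ * g w (n + 1) * ((n : L) ^ headExponent w)⁻¹ *
          ∑ v ∈ tailWord w, H v n := by
    intro w hw
    have h4 := h1 w hw
    have h5 : H w (n + 1) = (ζ w.1)⁻¹ *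
        (H w n + ((n : L) ^ headExponent w)⁻¹ * ∑ v ∈ tailWord w, H v n) := by
      rw [← h4, inv_mul_cancel_left₀ (hζ _)]
    rw [h5]
    ring
  have e4 : c * ∑ w ∈ S, g w (n + 1) * H w (n + 1) = 0 := by rw [h3, mul_zero]
  rw [Finset.mul_sum, Finset.sum_congr rfl e3, Finset.sum_add_distrib] at e4
  linear_combination -e4

variable [IsUltrametricDist L] [ProperSpace L] [CharZero L]

theorem shiftedRelation_mem [DecidableEq (Z × List (ℕ+ × Z))] {ζ : Z → L} {c : L}
    {S : Finset (Z × List (ℕ+ × Z))} {g : Z × List (ℕ+ × Z) → ℕ → L}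
    (hg : ∀ w, g w ∈ tateQuotients L)
    (v : Z × List (ℕ+ × Z)) : shiftedRelation ζ c S g v ∈ tateQuotients L := by
  refine sub_mem_tateQuotients (sub_mem_tateQuotients (hg v)
    (mul_mem_tateQuotients (const_mem_tateQuotients _) (shift_mem_tateQuotients (hg v))))
    (sum_mem_tateQuotients _ fun w _ => mul_mem_tateQuotients
      (mul_mem_tateQuotients (const_mem_tateQuotients _) (shift_mem_tateQuotients (hg w)))
      (inv_pow_mem_tateQuotients _))

variable {N : ℕ} {ζ : Z → L} {H : Z × List (ℕ+ × Z) → ℕ → L}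

/-- No normalized relation between iterated sums is such that the relation obtained from it by
translation is trivial. -/
theorem false_of_shiftedRelation_eq_zero [DecidableEq (Z × List (ℕ+ × Z))]
    [(nearInt L 0).NeBot] (hN : 0 < N)
    (hζN : ∀ z, ζ z ^ N = 1) (hζ : Function.Injective ζ)
    (hH0 : ∀ z, ∃ᶠ n in atTop, H (z, []) n ≠ 0)
    {S : Finset (Z × List (ℕ+ × Z))} {g : Z × List (ℕ+ × Z) → ℕ → L}
    (hg : ∀ w, g w ∈ tateQuotients L)
    (hrel : ∀ᶠ n in atTop, ∑ w ∈ S, g w n * H w n = 0) {u : Z × List (ℕ+ × Z)} (hu : u ∈ S)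
    (hgu : ∀ᶠ n in atTop, g u n = 1) (hmax : ∀ w ∈ S, w.2.length ≤ u.2.length)
    (htop : ∀ v ∈ S, v.2.length = u.2.length →
      ∀ᶠ n in atTop, shiftedRelation ζ (ζ u.1) S g v n = 0)
    (htail : ∀ v ∈ tailWord u, ∀ᶠ n in atTop, shiftedRelation ζ (ζ u.1) S g v n = 0) : False := by
  have hζ0 : ∀ z, ζ z ≠ 0 := fun z h => by
    have := hζN z
    rw [h, zero_pow hN.ne'] at this
    exact zero_ne_one this
  -- In top depth no tail contributes, so triviality says that g_v is an eigenvector of translation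
  -- with eigenvalue z_v/z_u.
  have hconst : ∀ v ∈ S, v.2.length = u.2.length → ∃ C, (∀ᶠ n in atTop, g v n = C) ∧
      (v.1 ≠ u.1 → C = 0) := by
    intro v hv hlen
    have h1 : ∀ᶠ n in atTop, g v (n + 1) = (ζ v.1 * (ζ u.1)⁻¹) * g v n := by
      filter_upwards [htop v hv hlen] with n hn
      rw [shiftedRelation, Finset.sum_eq_zero, sub_zero, sub_eq_zero] at hn
      · rw [hn]
        have := hζ0 v.1
        have := hζ0 u.1
        field_simp
      · intro w hw
        rw [Finset.mem_filter] at hw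
        have h1 := length_of_mem_tailWord hw.2
        have h2 := hmax w hw.1
        omega
    rcases eventually_eq_const_of_shift (hg v) hN
      (by rw [mul_pow, inv_pow, hζN, hζN, inv_one, mul_one]) h1 with h | ⟨h, C, hC⟩
    · exact ⟨0, h, fun _ => rfl⟩
    · refine ⟨C, hC, fun hne => absurd (hζ ?_) hne⟩
      exact eq_of_mul_inv_eq_one h
  choose! C hC hC0 using hconst
  have hCu : C u = 1 := by
    obtain ⟨n, h1, h2⟩ := ((hC u hu rfl).and hgu).exists
    rw [← h1, h2]
  -- In depth 0 the relation reduces to H_u = 0, against `hH0`. Otherwise the tail of `u` yields the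
  -- impossible difference equation.
  rcases hu' : u with ⟨z, _ | ⟨q, t⟩⟩
  · have h1 : ∀ w ∈ S, w ≠ u → ∀ᶠ n in atTop, g w n = 0 := by
      intro w hw hne
      have hlen : w.2.length = u.2.length := by
        have := hmax w hw
        simp [hu'] at this ⊢
        exact this
      have : C w = 0 := by
        refine hC0 w hw hlen fun h => hne (Prod.ext h ?_)
        rw [hu'] at hlen ⊢
        simpa using hlen
      rw [← this]
      exact hC w hw hlen
    have h2 : ∀ᶠ n in atTop, ∀ w ∈ S, w ≠ u → g w n = 0 := by
      refine (Filter.eventually_all_finset S).2 fun w hw => ?_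
      by_cases hne : w = u
      · exact Eventually.of_forall fun n h => absurd hne h
      · exact (h1 w hw hne).mono fun n hn _ => hn
    refine hH0 z ?_
    filter_upwards [h2, hrel, hgu] with n h2 h3 h4
    rw [Finset.sum_eq_single u (fun w hw hne => by rw [h2 w hw hne, zero_mul])
      (fun h => absurd hu h), h4, one_mul, hu'] at h3
    exact not_not.2 h3
  · set v : Z × List (ℕ+ × Z) := (q.2, t) with hv
    have hvu : v ∈ tailWord u := by rw [hu']; simp [tailWord, hv]
    set T := S.filter fun w => v ∈ tailWord w with hT
    have huT : u ∈ T := Finset.mem_filter.2 ⟨hu, hvu⟩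
    have hTS : ∀ w ∈ T, w ∈ S ∧ w.2.length = u.2.length := by
      intro w hw
      rw [hT, Finset.mem_filter] at hw
      exact ⟨hw.1, by rw [length_of_mem_tailWord hw.2, length_of_mem_tailWord hvu]⟩
    let Q : Polynomial L := ∑ w ∈ T, Polynomial.monomial (headExponent w) (C w)
    -- Another word with the same tail and exponent has a different root of unity, so its constant
    -- is 0 and cannot cancel that of `u`.
    have hQcoeff : Q.coeff (headExponent u) = 1 := by
      simp only [Q, Polynomial.finsetSum_coeff, Polynomial.coeff_monomial]
      rw [Finset.sum_eq_single u]
      · simp [hCu]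
      · intro w hw hne
        split_ifs with h
        · refine hC0 w (hTS w hw).1 (hTS w hw).2 fun h1 => hne ?_
          exact eq_of_mem_tailWord (Finset.mem_filter.1 hw).2 hvu h1 h
        · rfl
      · exact fun h => absurd huT h
    have hQ : 0 < Q.degree := by
      rw [← Polynomial.natDegree_pos_iff_degree_pos]
      exact (headExponent_pos u).trans_le
        (Polynomial.le_natDegree_of_ne_zero (by rw [hQcoeff]; exact one_ne_zero))
    refine not_eventually_sub_shift_eq (hg v) (c := ζ u.1 * (ζ v.1)⁻¹)
      (mul_ne_zero (hζ0 _) (inv_ne_zero (hζ0 _))) hQ ?_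
    have hall : ∀ᶠ n in atTop, ∀ w ∈ T, g w (n + 1) = C w :=
      (Filter.eventually_all_finset T).2 fun w hw =>
        (tendsto_add_atTop_nat 1).eventually (hC w (hTS w hw).1 (hTS w hw).2)
    filter_upwards [htail v hvu, hall] with n hn h1
    rw [shiftedRelation, sub_eq_zero] at hn
    rw [hn]
    simp only [Q, Polynomial.eval_finsetSum, Polynomial.eval_monomial]
    refine Finset.sum_congr (by rw [hT]) fun w hw => ?_
    rw [h1 w hw, inv_pow]
    by_cases hw1 : w.1 = u.1
    · rw [hw1, mul_inv_cancel₀ (hζ0 _), one_mul]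
    · rw [hC0 w (hTS w hw).1 (hTS w hw).2 hw1]
      simp

/-- Iterated sums twisted by roots of unity are linearly independent over the quotients of
convergent power series. -/
theorem eventually_eq_zero_of_relation [(nearInt L 0).NeBot] (hN : 0 < N)
    (hζN : ∀ z, ζ z ^ N = 1) (hζ : Function.Injective ζ)
    (hH : SatisfiesHarmonicRecurrence ζ H) (hH0 : ∀ z, ∃ᶠ n in atTop, H (z, []) n ≠ 0)
    (S : Finset (Z × List (ℕ+ × Z))) (g : Z × List (ℕ+ × Z) → ℕ → L)
    (hg : ∀ w, g w ∈ tateQuotients L)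
    (hrel : ∀ᶠ n in atTop, ∑ w ∈ S, g w n * H w n = 0) :
    ∀ w ∈ S, ∀ᶠ n in atTop, g w n = 0 := by
  classical
  have hζ0 : ∀ z, ζ z ≠ 0 := fun z h => by
    have := hζN z
    rw [h, zero_pow hN.ne'] at this
    exact zero_ne_one this
  -- Double induction: on a strict bound `d` for the depth, then on a bound `k` for the number of
  -- nonzero coefficients in top depth.
  suffices key : ∀ d k : ℕ, ∀ (S : Finset (Z × List (ℕ+ × Z))) (g : Z × List (ℕ+ × Z) → ℕ → L),
      (∀ w, g w ∈ tateQuotients L) → (∀ w ∈ S, w.2.length < d) →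
      (S.filter fun w => w.2.length + 1 = d ∧ ¬ ∀ᶠ n in atTop, g w n = 0).card ≤ k →
      (∀ᶠ n in atTop, ∑ w ∈ S, g w n * H w n = 0) → ∀ w ∈ S, ∀ᶠ n in atTop, g w n = 0 by
    exact key (S.sup (fun w => w.2.length) + 1) _ S g hg
      (fun w hw => Nat.lt_succ_of_le (Finset.le_sup (f := fun w => w.2.length) hw)) le_rfl hrel
  clear hrel hg g S
  intro d
  induction d with
  | zero => exact fun k S g _ hS _ _ w hw => absurd (hS w hw) (Nat.not_lt_zero _)
  | succ d ihd =>
    intro k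
    induction k with
    | zero =>
      intro S g hg hS hcard hrel
      rw [Nat.le_zero, Finset.card_eq_zero, Finset.filter_eq_empty_iff] at hcard
      have htop : ∀ w ∈ S, w.2.length = d → ∀ᶠ n in atTop, g w n = 0 := by
        intro w hw hlen
        by_contra h
        exact hcard hw ⟨by omega, h⟩
      have hlow := ihd _ (S.filter fun w => w.2.length < d) g hg
        (fun w hw => (Finset.mem_filter.1 hw).2) le_rfl (by
          have hall : ∀ᶠ n in atTop, ∀ w ∈ S, ¬ w.2.length < d → g w n = 0 := by
            refine (Filter.eventually_all_finset S).2 fun w hw => ?_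
            by_cases hlt : w.2.length < d
            · exact Eventually.of_forall fun n h => absurd hlt h
            · exact (htop w hw (by have := hS w hw; omega)).mono fun n hn _ => hn
          filter_upwards [hrel, hall] with n h1 h2
          rw [← h1]
          refine Finset.sum_filter_of_ne fun w hw hne => ?_
          by_contra hlt
          exact hne (by rw [h2 w hw hlt, zero_mul]))
      intro w hw
      by_cases hlt : w.2.length < d
      · exact hlow w (Finset.mem_filter.2 ⟨hw, hlt⟩)
      · exact htop w hw (by have := hS w hw; omega)
    | succ k ihk =>
      intro S g hg hS hcard hrel
      by_cases hle : (S.filter fun w => w.2.length + 1 = d + 1 ∧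
          ¬ ∀ᶠ n in atTop, g w n = 0).card ≤ k
      · exact ihk S g hg hS hle hrel
      exfalso
      obtain ⟨u, hu⟩ := Finset.card_pos.1 (lt_of_le_of_lt (Nat.zero_le k) (not_le.1 hle))
      obtain ⟨huS, hulen, hu0⟩ := Finset.mem_filter.1 hu
      have hu1 := (eventually_eq_zero_or_ne (hg u)).resolve_left hu0
      let g' : Z × List (ℕ+ × Z) → ℕ → L := fun w =>
        if w ∈ S then fun n => g w n * (g u n)⁻¹ else 0
      have hg' : ∀ w, g' w ∈ tateQuotients L := by
        intro w
        by_cases hw : w ∈ S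
        · simp only [g', if_pos hw]
          exact mul_mem_tateQuotients (hg w) (inv_mem_tateQuotients (hg u))
        · simp only [g', if_neg hw]
          exact const_mem_tateQuotients 0
      have hrel' : ∀ᶠ n in atTop, ∑ w ∈ S, g' w n * H w n = 0 := by
        filter_upwards [hrel] with n hn
        have : ∀ w ∈ S, g' w n * H w n = (g u n)⁻¹ * (g w n * H w n) := by
          intro w hw
          simp only [g', if_pos hw]
          ring
        rw [Finset.sum_congr rfl this, ← Finset.mul_sum, hn, mul_zero]
      have hgu' : ∀ᶠ n in atTop, g' u n = 1 := by
        filter_upwards [hu1] with n hn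
        simp only [g', if_pos huS]
        exact mul_inv_cancel₀ hn
      have hg'0 : ∀ w, w ∉ S → g' w = 0 := fun w hw => by simp only [g', if_neg hw]
      have htailS : ∀ w ∈ S, ∀ v ∈ tailWord w, v.2.length < d := by
        intro w hw v hv
        have h1 := length_of_mem_tailWord hv
        have h2 := hS w hw
        omega
      have hD := shiftedRelation_eq hζ0 hH (ζ u.1) hg'0 hrel'
      have htop : ∀ v, v.2.length = d → ∀ n, shiftedRelation ζ (ζ u.1) S g' v n =
          g' v n - ζ u.1 * (ζ v.1)⁻¹ * g' v (n + 1) := by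
        intro v hv n
        rw [shiftedRelation, Finset.sum_eq_zero, sub_zero]
        intro w hw
        rw [Finset.mem_filter] at hw
        have := htailS w hw.1 v hw.2
        omega
      have hDu : ∀ᶠ n in atTop, shiftedRelation ζ (ζ u.1) S g' u n = 0 := by
        filter_upwards [hgu', (tendsto_add_atTop_nat 1).eventually hgu'] with n h1 h2
        rw [htop u (by omega), h1, h2, mul_inv_cancel₀ (hζ0 _)]
        ring
      have hDall := ihk (S ∪ S.biUnion tailWord) (shiftedRelation ζ (ζ u.1) S g')
        (fun v => shiftedRelation_mem hg' v) (by
          intro v hv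
          rcases Finset.mem_union.1 hv with hv | hv
          · exact hS v hv
          · obtain ⟨w, hw, hv⟩ := Finset.mem_biUnion.1 hv
            have := htailS w hw v hv
            omega) (by
          -- The shift creates no nonzero coefficient in top depth and kills the one at `u`, so the
          -- count drops.
          refine (Finset.card_le_card (t := (S.filter fun w => w.2.length + 1 = d + 1 ∧
            ¬ ∀ᶠ n in atTop, g w n = 0).erase u) ?_).trans ?_
          · intro v hv
            obtain ⟨-, hlen, hv0⟩ := Finset.mem_filter.1 hv
            have hvS : v ∈ S := by
              by_contra hvS
              refine hv0 (Eventually.of_forall fun n => ?_)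
              rw [htop v (by omega), hg'0 v hvS]
              simp
            refine Finset.mem_erase.2 ⟨?_, Finset.mem_filter.2 ⟨hvS, hlen, fun h => hv0 ?_⟩⟩
            · rintro rfl
              exact hv0 hDu
            · filter_upwards [h, (tendsto_add_atTop_nat 1).eventually h] with n h1 h2
              rw [htop v (by omega)]
              simp only [g', if_pos hvS, h1, h2]
              simp
          · rw [Finset.card_erase_of_mem hu]
            omega) hD
      refine false_of_shiftedRelation_eq_zero hN hζN hζ hH0 hg' hrel' huS hgu' (fun w hw => ?_)
        (fun v hv _ => hDall v (Finset.mem_union_left _ hv))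
        (fun v hv => hDall v (Finset.mem_union_right _ (Finset.mem_biUnion.2 ⟨u, huS, hv⟩)))
      have := hS w hw
      omega

end Independence

/-! ### Bounded linear forms over a locally compact ultrametric field. -/

section HahnBanach

variable {L : Type*} [NormedField L] [IsUltrametricDist L] [ProperSpace L] {E : Type*}
  [NormedAddCommGroup E] [NormedSpace L E] [IsUltrametricDist E]

/-- Balls of a locally compact ultrametric field that meet pairwise have a common point. -/
theorem exists_norm_add_le {f : E →ₗ.[L] L} {C : ℝ} (hC : 0 ≤ C)
    (hf : ∀ e : f.domain, ‖f e‖ ≤ C * ‖(e : E)‖) (y : E) :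
    ∃ c : L, ∀ e : f.domain, ‖f e + c‖ ≤ C * ‖(e : E) + y‖ := by
  let B : f.domain → Set L := fun e => Metric.closedBall (-f e) (C * ‖(e : E) + y‖)
  -- The bound on `f` and the ultrametric inequality make the balls totally ordered by radius;
  -- compactness then gives a common point.
  have hB : ∀ e e' : f.domain, C * ‖(e : E) + y‖ ≤ C * ‖(e' : E) + y‖ → B e ⊆ B e' := by
    intro e e' hle x hx
    simp only [B, Metric.mem_closedBall, dist_eq_norm] at hx ⊢
    have h1 : ‖f e - f e'‖ ≤ C * ‖(e' : E) + y‖ := by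
      rw [← LinearPMap.map_sub]
      refine (hf _).trans ?_
      have h2 : ((e - e' : f.domain) : E) = ((e : E) + y) + -((e' : E) + y) := by
        push_cast
        abel
      rw [h2]
      refine (mul_le_mul_of_nonneg_left (IsUltrametricDist.norm_add_le_max _ _) hC).trans ?_
      rw [norm_neg, mul_max_of_nonneg _ _ hC]
      exact max_le hle le_rfl
    have h3 : x - -f e' = (x - -f e) + -(f e - f e') := by ring
    rw [h3]
    exact (IsUltrametricDist.norm_add_le_max _ _).trans
      (max_le (hx.trans hle) (by rwa [norm_neg]))
  have hne : (⋂ e, B e).Nonempty := by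
    refine IsCompact.nonempty_iInter_of_directed_nonempty_isCompact_isClosed B ?_ ?_ ?_ ?_
    · intro e e'
      rcases le_total (C * ‖(e : E) + y‖) (C * ‖(e' : E) + y‖) with h | h
      · exact ⟨e, subset_rfl, hB e e' h⟩
      · exact ⟨e', hB e' e h, subset_rfl⟩
    · exact fun e => ⟨-f e, Metric.mem_closedBall_self (by positivity)⟩
    · exact fun e => isCompact_closedBall _ _
    · exact fun e => Metric.isClosed_closedBall
  obtain ⟨c, hc⟩ := hne
  refine ⟨c, fun e => ?_⟩
  have := Set.mem_iInter.1 hc e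
  simpa only [B, Metric.mem_closedBall, dist_eq_norm, sub_neg_eq_add, add_comm] using this

theorem exists_lt_linearPMap {f : E →ₗ.[L] L} {C : ℝ} (hC : 0 ≤ C)
    (hf : ∀ e : f.domain, ‖f e‖ ≤ C * ‖(e : E)‖) (hdom : f.domain ≠ ⊤) :
    ∃ g, f < g ∧ ∀ e : g.domain, ‖g e‖ ≤ C * ‖(e : E)‖ := by
  obtain ⟨y, -, hy⟩ : ∃ y ∈ ⊤, y ∉ f.domain := SetLike.exists_of_lt (lt_top_iff_ne_top.2 hdom)
  obtain ⟨c, hc⟩ := exists_norm_add_le hC hf y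
  refine ⟨f.supSpanSingleton y c hy, ?_, ?_⟩
  · refine lt_iff_le_not_ge.2 ⟨f.left_le_sup _ _, fun H => ?_⟩
    replace H := LinearPMap.domain_mono.monotone H
    rw [LinearPMap.domain_supSpanSingleton, sup_le_iff, Submodule.span_le,
      Set.singleton_subset_iff] at H
    exact hy H.2
  · rintro ⟨z, hz⟩
    rcases Submodule.mem_sup.1 hz with ⟨x, hx, y', hy', rfl⟩
    rcases Submodule.mem_span_singleton.1 hy' with ⟨r, rfl⟩
    simp only [LinearPMap.supSpanSingleton_apply_mk _ _ _ _ _ hx, RingHom.id_apply]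
    by_cases hr : r = 0
    · subst hr
      simpa using hf ⟨x, hx⟩
    · have h := hc (r⁻¹ • ⟨x, hx⟩)
      have h1 : f ⟨x, hx⟩ + r • c = r • (f (r⁻¹ • ⟨x, hx⟩) + c) := by
        rw [LinearPMap.map_smul, smul_add, smul_inv_smul₀ hr]
      have h2 : x + r • y = r • (((r⁻¹ • ⟨x, hx⟩ : f.domain) : E) + y) := by
        rw [smul_add]
        simp [smul_inv_smul₀ hr]
      rw [h1, h2, norm_smul, norm_smul, mul_left_comm]
      exact mul_le_mul_of_nonneg_left h (norm_nonneg _)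

/-- Zorn's lemma for extensions with the same constant `C`; a maximal one is total by the one-vector
extension. -/
theorem exists_linearPMap_domain_eq_top {f : E →ₗ.[L] L} {C : ℝ} (hC : 0 ≤ C)
    (hf : ∀ e : f.domain, ‖f e‖ ≤ C * ‖(e : E)‖) :
    ∃ g ≥ f, g.domain = ⊤ ∧ ∀ e : g.domain, ‖g e‖ ≤ C * ‖(e : E)‖ := by
  set S := {g : E →ₗ.[L] L | ∀ e : g.domain, ‖g e‖ ≤ C * ‖(e : E)‖}
  have hSc : ∀ c, c ⊆ S → IsChain (· ≤ ·) c → ∀ y ∈ c, ∃ ub ∈ S, ∀ z ∈ c, z ≤ ub := by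
    intro c hcs c_chain y hy
    have cne : c.Nonempty := ⟨y, hy⟩
    have hcd : DirectedOn (· ≤ ·) c := c_chain.directedOn
    refine ⟨LinearPMap.sSup c hcd, ?_, fun _ ↦ LinearPMap.le_sSup hcd⟩
    rintro ⟨x, hx⟩
    have hdir : DirectedOn (· ≤ ·) (LinearPMap.domain '' c) :=
      directedOn_image.2 (hcd.mono LinearPMap.domain_mono.monotone)
    rcases (Submodule.mem_sSup_of_directed (cne.image _) hdir).1 hx with ⟨_, ⟨g, hgc, rfl⟩, hgx⟩
    have : g ≤ LinearPMap.sSup c hcd := LinearPMap.le_sSup _ hgc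
    have h := hcs hgc ⟨x, hgx⟩
    rwa [this.2 (y := ⟨x, hx⟩) rfl] at h
  obtain ⟨q, hpq, hqs, hq⟩ := zorn_le_nonempty₀ S hSc f hf
  refine ⟨q, hpq, ?_, hqs⟩
  by_contra hdom
  obtain ⟨r, hqr, hr⟩ := exists_lt_linearPMap hC hqs hdom
  exact hqr.not_ge (hq hr hqr.le)

/-- The bounded linear forms on an ultrametric normed space over a locally compact field separate
the points. -/
theorem exists_bounded_linearMap_ne_zero {x : E} (hx : x ≠ 0) :
    ∃ (φ : E →ₗ[L] L) (C : ℝ), φ x ≠ 0 ∧ ∀ y, ‖φ y‖ ≤ C * ‖y‖ := by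
  let f : E →ₗ.[L] L := LinearPMap.mkSpanSingleton x (1 : L) hx
  have hC : 0 ≤ ‖x‖⁻¹ := by positivity
  obtain ⟨⟨g_dom, g⟩, ⟨-, hfg⟩, rfl : g_dom = ⊤, hg⟩ :=
    exists_linearPMap_domain_eq_top (f := f) hC (by
    rintro ⟨e, he⟩
    obtain ⟨c, rfl⟩ := Submodule.mem_span_singleton.1 he
    have h1 : f ⟨c • x, he⟩ = c • (1 : L) :=
      LinearPMap.mkSpanSingleton'_apply _ _ _ _ _
    rw [h1]
    simp only [smul_eq_mul, mul_one, norm_smul]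
    rw [mul_left_comm, inv_mul_cancel₀ (norm_ne_zero_iff.2 hx), mul_one])
  refine ⟨g.comp (LinearMap.id.codRestrict ⊤ fun _ ↦ trivial), ‖x‖⁻¹, ?_, fun y => hg ⟨y, trivial⟩⟩
  have h2 : f ⟨x, Submodule.mem_span_singleton_self x⟩ = 1 :=
    LinearPMap.mkSpanSingleton_apply L L hx 1
  have h3 : g ⟨x, trivial⟩ = 1 := by
    rw [← h2]
    exact (hfg rfl).symm
  change g ⟨x, trivial⟩ ≠ 0
  rw [h3]
  exact one_ne_zero

end HahnBanach

/-! ### Reduction of coefficients from A to L. -/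

section IteratedSums

/-- Iterated sums twisted by roots of unity, with values in a locally compact field, are linearly
independent over the analytic functions with coefficients in an ultrametric algebra. -/
theorem linearIndependent_of_harmonicRecurrence {L : Type*} [NontriviallyNormedField L]
    [IsUltrametricDist L] [ProperSpace L] [CharZero L] [(nearInt L 0).NeBot]
    {A : Type*} [NormedCommRing A] [NormedAlgebra L A] [IsUltrametricDist A]
    {Z : Type*} {N : ℕ} {ζ : Z → L} {H : Z × List (ℕ+ × Z) → ℕ → L} (hN : 0 < N)
    (hζN : ∀ z, ζ z ^ N = 1) (hζ : Function.Injective ζ)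
    (hH : SatisfiesHarmonicRecurrence ζ H) (hH0 : ∀ z, ∃ᶠ n in atTop, H (z, []) n ≠ 0)
    (e : Z × List (ℕ+ × Z) → ℕ) :
    LinearIndependent (analyticRing A)
      (fun (w : Z × List (ℕ+ × Z)) (n : ℕ+) =>
        algebraMap L A ((((n : ℕ) : L)) ^ e w * H w n)) := by
  rw [linearIndependent_iff']
  intro S g hrel w hw
  by_contra hne
  obtain ⟨m, hm⟩ : ∃ m : ℕ+, (g w : ℕ+ → A) m ≠ 0 := by
    by_contra h
    push Not at h
    exact hne (Subtype.ext (funext h))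
  -- Applying φ to the power series coefficients keeps the relation, since the sums take values in
  -- L, and keeps the coefficient at `w` nonzero.
  obtain ⟨φ, C, hφ, hC⟩ := exists_bounded_linearMap_ne_zero (L := L) hm
  have hcont : Continuous φ := AddMonoidHomClass.continuous_of_bound φ C hC
  choose F hF hF' using fun v => (g v).2
  have ha : ∀ v, Tendsto (fun k => φ (PowerSeries.coeff k (F v))) atTop (𝓝 0) := by
    intro v
    have h := (PowerSeries.isRestricted_iff' _ _).1 (hF v)
    simp only [one_pow, mul_one] at h
    simpa [Function.comp_def] using
      (hcont.tendsto 0).comp (tendsto_zero_iff_norm_tendsto_zero.2 h)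
  let f : Z × List (ℕ+ × Z) → L → L := fun v x =>
    ∑' k, φ (PowerSeries.coeff k (F v)) * x ^ k
  have hf : ∀ v, IsTate (f v) := fun v => isTate_tsum (ha v)
  have hval : ∀ v (n : ℕ+), f v (n : ℕ) = φ ((g v : ℕ+ → A) n) := by
    intro v n
    refine HasSum.tsum_eq ?_
    have h := (hF' v n).map φ hcont
    convert h using 2 with k
    have : PowerSeries.coeff k (F v) * ((n : ℕ) : A) ^ k =
        (((n : ℕ) : L) ^ k) • PowerSeries.coeff k (F v) := by
      rw [Algebra.smul_def, map_pow, map_natCast, mul_comm]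
    rw [Function.comp_apply, this, map_smul, smul_eq_mul, mul_comm]
  have hnat : ∀ s : ℕ, (fun n : ℕ => (n : L) ^ s) ∈ tateQuotients L := fun s => by
    simpa using inv_mem_tateQuotients (inv_pow_mem_tateQuotients (L := L) s)
  -- The weight factor n^e is absorbed into the coefficients.
  have hev := eventually_eq_zero_of_relation hN hζN hζ hH hH0 S
    (fun v n => f v n * (n : L) ^ e v)
    (fun v => mul_mem_tateQuotients (hf v).mem_tateQuotients (hnat _)) (by
      filter_upwards [eventually_gt_atTop 0] with n hn
      obtain ⟨k, rfl⟩ : ∃ k : ℕ+, (k : ℕ) = n := ⟨⟨n, hn⟩, rfl⟩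
      have h := congrArg φ (congrFun hrel k)
      rw [Pi.zero_apply, map_zero, Finset.sum_apply, map_sum] at h
      rw [← h]
      refine Finset.sum_congr rfl fun v _ => ?_
      rw [hval, Subring.smul_def, smul_eq_mul, Pi.mul_apply, mul_comm ((g v : ℕ+ → A) _),
        ← Algebra.smul_def, map_smul, smul_eq_mul]
      ring) w hw
  have hzero : ∀ᶠ n : ℕ in atTop, f w n = 0 := by
    filter_upwards [hev, eventually_gt_atTop 0] with n h1 h2
    exact (mul_eq_zero.1 h1).resolve_right (pow_ne_zero _ (Nat.cast_ne_zero.2 h2.ne'))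
  rcases (hf w).eq_zero_or_eventually_ne with h | h
  · exact hφ (by rw [← hval, h _ (norm_natCast_le_one' _)])
  · obtain ⟨n, h1, h2⟩ := (h.and hzero).exists
    exact h1 h2

end IteratedSums

/-! ### Application to multiple harmonic sums. -/

section HarmonicSums

variable {N : ℕ} {K : Type*} [Field K]

theorem sum_Ioo_succ {M : Type*} [AddCommMonoid M] (f : ℕ → M) {n : ℕ} (hn : 0 < n) :
    ∑ m ∈ Finset.Ioo 0 (n + 1), f m = ∑ m ∈ Finset.Ioo 0 n, f m + f n := by
  have : Finset.Ioo 0 (n + 1) = insert n (Finset.Ioo 0 n) := by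
    ext m
    simp
    omega
  rw [this, Finset.sum_insert (by simp), add_comm]

/-- The new value m = n of the largest index contributes the tail sum; its factor z^n cancels
against z^{-(n+1)} times the outer z. For n = 0 there is no new index. -/
theorem mhs_succ (w : HarWord N K) {n : ℕ} (hn : 0 < n) :
    ((w.1 : Kˣ) : K) * mhs w.1 w.2 (n + 1) =
      mhs w.1 w.2 n + ((n : K) ^ headExponent w)⁻¹ * ∑ v ∈ tailWord w, mhs v.1 v.2 n := by
  rcases w with ⟨z, _ | ⟨⟨s, y⟩, t⟩⟩
  · have hz : ((z : Kˣ) : K) ≠ 0 := Units.ne_zero _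
    simp [mhs, tailWord, pow_succ]
  · have hz : ((z : Kˣ) : K) ≠ 0 := Units.ne_zero _
    simp only [mhs, tailWord, headExponent, Finset.sum_singleton, sum_Ioo_succ _ hn]
    generalize ∑ m ∈ Finset.Ioo 0 n, ((z : Kˣ) : K) ^ m * ((m : K) ^ (s : ℕ))⁻¹ * mhs y t m = X
    generalize ((n : K) ^ (s : ℕ))⁻¹ = Y
    rw [pow_succ]
    field_simp

theorem mhs_mem {F : Type*} [Field F] [Algebra F K] (L : IntermediateField F K)
    (hL : ∀ z : rootsOfUnity N K, ((z : Kˣ) : K) ∈ L) (l : List (ℕ+ × rootsOfUnity N K))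
    (z : rootsOfUnity N K) (n : ℕ) : mhs z l n ∈ L := by
  induction l generalizing z n with
  | nil => exact L.inv_mem (pow_mem (hL z) n)
  | cons q t ih =>
    exact L.mul_mem (L.inv_mem (pow_mem (hL z) n)) (L.sum_mem fun m _ =>
      L.mul_mem (L.mul_mem (pow_mem (hL z) m) (L.inv_mem (pow_mem (natCast_mem L m) _)))
        (ih q.2 m))

/-- Multiple harmonic sums are linearly independent over the analytic functions. -/
theorem linearIndependent_har (p : ℕ) [Fact p.Prime] {N : ℕ} (hN : 0 < N) {K : Type*}
    [NormedField K] [NormedAlgebra ℚ_[p] K] (hK : ∃ ξ : K, IsPrimitiveRoot ξ N)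
    (A : Type*) [NormedCommRing A] [NormedAlgebra K A] [IsUltrametricDist A] :
    LinearIndependent (analyticRing A)
      (fun (w : HarWord N K) (n : ℕ+) => algebraMap K A (har w n)) := by
  obtain ⟨ξ, hξ⟩ := hK
  -- K need not be locally compact, but this finite extension of ℚ_p is, and it contains all values
  -- of the sums.
  let L : IntermediateField ℚ_[p] K := IntermediateField.adjoin ℚ_[p] {ξ}
  have hξL : ξ ∈ L := IntermediateField.mem_adjoin_simple_self _ _
  have hint : IsIntegral ℚ_[p] ξ :=
    ⟨Polynomial.X ^ N - 1, Polynomial.monic_X_pow_sub_C 1 hN.ne', by simp [hξ.pow_eq_one]⟩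
  have hfd : FiniteDimensional ℚ_[p] L := IntermediateField.adjoin.finiteDimensional hint
  have hL : ∀ z : rootsOfUnity N K, ((z : Kˣ) : K) ∈ L := by
    intro z
    have hz : ((z : Kˣ) : K) ^ N = 1 := by
      rw [← Units.val_pow_eq_pow_val, (mem_rootsOfUnity N _).1 z.2, Units.val_one]
    have : NeZero N := ⟨hN.ne'⟩
    obtain ⟨i, -, hi⟩ := hξ.eq_pow_of_pow_eq_one hz
    rw [← hi]
    exact pow_mem hξL i
  have : IsUltrametricDist L :=
    IsUltrametricDist.isUltrametricDist_of_forall_norm_natCast_le_one fun n => by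
      rw [← map_natCast (algebraMap ℚ_[p] L), norm_algebraMap']
      exact IsUltrametricDist.norm_natCast_le_one _ n
  have : ProperSpace L := FiniteDimensional.proper ℚ_[p] L
  have : CharZero L := charZero_of_injective_algebraMap (algebraMap ℚ_[p] L).injective
  have : (nearInt L 0).NeBot := nearInt_neBot p 0
  let _ : NormedAlgebra L K :=
    { (inferInstance : Algebra L K) with norm_smul_le := fun a b => norm_mul_le (a : K) b }
  let _ : NormedAlgebra L A := NormedAlgebra.restrictScalars L K A
  let ζ : rootsOfUnity N K → L := fun z => ⟨((z : Kˣ) : K), hL z⟩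
  let H : HarWord N K → ℕ → L := fun w n => ⟨mhs w.1 w.2 n, mhs_mem L hL _ _ _⟩
  have h := linearIndependent_of_harmonicRecurrence (A := A) (ζ := ζ) (H := H) hN
    (fun z => Subtype.ext (by
      change ((z : Kˣ) : K) ^ N = 1
      rw [← Units.val_pow_eq_pow_val, (mem_rootsOfUnity N _).1 z.2, Units.val_one]))
    (fun z y hzy => Subtype.ext (Units.ext (congrArg (Subtype.val : L → K) hzy)))
    (fun w => by
      filter_upwards [eventually_gt_atTop 0] with n hn
      refine Subtype.ext ?_
      have h1 := mhs_succ w hn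
      push_cast
      exact h1)
    (fun z => Eventually.frequently (Eventually.of_forall fun n h => by
      have h1 : mhs z [] n = 0 := congrArg (Subtype.val : L → K) h
      exact inv_ne_zero (pow_ne_zero n (Units.ne_zero _)) h1))
    (fun w => (w.2.map (fun q => (q.1 : ℕ))).sum)
  exact h

/-- A quotient of two roots with equal k-th powers has order dividing both N and k. Twisting
therefore only reindexes the family injectively. -/
theorem twist_injective {k : ℕ} (hk : N.Coprime k) :
    Function.Injective (HarWord.twist k : HarWord N K → HarWord N K) := by
  have hpow : Function.Injective fun z : rootsOfUnity N K => z ^ k := by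
    intro z y h
    have h1 : (z * y⁻¹) ^ k = 1 := by
      rw [mul_pow, inv_pow, mul_inv_eq_one]
      exact h
    have h2 : (z * y⁻¹) ^ N = 1 := Subtype.ext ((mem_rootsOfUnity N _).1 (z * y⁻¹).2)
    have h3 := pow_gcd_eq_one.2 ⟨h2, h1⟩
    rw [hk.gcd_eq_one, pow_one] at h3
    exact mul_inv_eq_one.1 h3
  intro w w' h
  obtain ⟨h1, h2⟩ := Prod.ext_iff.1 h
  refine Prod.ext (hpow h1) ?_
  refine List.map_injective_iff.2 ?_ h2
  intro q q' hq
  obtain ⟨h3, h4⟩ := Prod.ext_iff.1 hq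
  exact Prod.ext h3 (hpow h4)

theorem replicate_append_some_inj {L : Type*} {i j : ℕ} {z y : L} {s t : List (Option L)}
    (h : List.replicate i none ++ some z :: s = List.replicate j none ++ some y :: t) :
    i = j ∧ z = y ∧ s = t := by
  induction i generalizing j with
  | zero =>
    cases j with
    | zero => simpa using h
    | succ j => simp [List.replicate_succ] at h
  | succ i ih =>
    cases j with
    | zero => simp [List.replicate_succ] at h
    | succ j =>
      simp only [List.replicate_succ, List.cons_append, List.cons.injEq, true_and] at h
      have := ih h
      simpa using this

theorem flatMap_injective : Function.Injective (fun q : List (ℕ+ × rootsOfUnity N K) =>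
    (q.flatMap (fun q => List.replicate ((q.1 : ℕ) - 1) none ++ [some q.2]) : Word N K)) := by
  intro l l' h
  induction l generalizing l' with
  | nil =>
    cases l' with
    | nil => rfl
    | cons q l' => simp at h
  | cons q l ih =>
    cases l' with
    | nil => simp at h
    | cons q' l' =>
      simp only [List.flatMap_cons, List.append_assoc, List.singleton_append] at h
      obtain ⟨h1, h2, h3⟩ := replicate_append_some_inj h
      rw [ih h3]
      congr 1
      refine Prod.ext (PNat.eq ?_) h2
      have := q.1.pos
      have := q'.1.pos
      omega

theorem replicate_append_toWord_injective : Function.Injective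
    (fun q : ℕ × HarWord N K => List.replicate q.1 none ++ q.2.toWord) := by
  rintro ⟨i, z, l⟩ ⟨j, y, l'⟩ h
  obtain ⟨rfl, rfl, h3⟩ := replicate_append_some_inj h
  exact Prod.ext rfl (Prod.ext rfl (flatMap_injective h3))

variable {A : Type*} [CommRing A] [Algebra K A]

theorem harSeq_replicate_append_toWord (k n l : ℕ) (w : HarWord N K) :
    harSeq N K A k n (List.replicate l none ++ w.toWord) = algebraMap K A (har (w.twist k) n) :=
  replicate_append_toWord_injective.extend_apply _ _ (l, w)

theorem harSeq_mem_drrtSpace (k n : ℕ) : harSeq N K A k n ∈ drrtSpace N K A := by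
  intro w l
  by_cases hw : ∃ q : ℕ × HarWord N K, List.replicate q.1 none ++ q.2.toWord = w
  · obtain ⟨⟨i, q⟩, rfl⟩ := hw
    rw [← List.append_assoc, ← List.replicate_add, harSeq_replicate_append_toWord,
      harSeq_replicate_append_toWord]
  · rw [harSeq, Function.extend_apply' _ _ _ hw, Function.extend_apply']
    · rfl
    · rintro ⟨⟨i, q⟩, h⟩
      refine hw ?_
      simp only at h
      obtain ⟨j, h' | ⟨y, s, h'⟩⟩ := eq_replicate_or_eq_replicate_append w
      · rw [h', ← List.replicate_add, HarWord.toWord] at h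
        have : (some q.1 : Letter N K) ∈ List.replicate (l + j) none := by
          rw [← h]
          simp
        simp [List.mem_replicate] at this
      · rw [h', ← List.append_assoc, ← List.replicate_add] at h
        obtain ⟨-, h1, h2⟩ := replicate_append_some_inj h
        refine ⟨(j, q), ?_⟩
        rw [h', HarWord.toWord, ← h1, ← h2]

end HarmonicSums

/-! ### Comparison of the two rings and assembly of stability. -/

section Inclusions

variable {N : ℕ} {K : Type*} [Field K] {A : Type*} [NormedCommRing A]

theorem independentSequences_anti {R R' : Subring (ℕ+ → A)} (h : R ≤ R') :
    independentSequences N K R' ⊆ independentSequences N K R := by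
  rintro s ⟨h1, h2⟩
  refine ⟨h1, ?_⟩
  rw [linearIndependent_iff'] at h2 ⊢
  intro S g hg i hi
  have := h2 S (fun i => Subring.inclusion h (g i)) hg i hi
  exact Subtype.ext (congrArg (Subtype.val : R' → ℕ+ → A) this)

variable [IsUltrametricDist A]

theorem overconvergentRing_le_analyticRing : overconvergentRing A ≤ analyticRing A := by
  rintro f ⟨r, hr, hf⟩
  exact hf.mono zero_le_one hr.le

variable [CompleteSpace A] [Algebra ℚ A] [Finite (rootsOfUnity N K)]

theorem harAction_mem_of_mem_adSet {R : Subring (ℕ+ → A)} (hR : ∀ a : A, (fun _ => a) ∈ R)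
    (hid : (fun n : ℕ+ => ((n : ℕ) : A)) ∈ R) {S : Set (NCSeries N K A)}
    (hS : S ⊆ PiTilde N K A)
    (hSR : ∀ g ∈ S, ∀ u, depth u ≠ 0 → SumsIn R (fun i => g (List.replicate i none ++ u)))
    {x : NCSeries N K A} (hx : x ∈ adSet S) {h : ℕ → NCSeries N K A}
    (hh : h ∈ independentSequences N K R) :
    (∀ n, adIhara (adScale n x) (h n) ∈ limSpace N K A) ∧
      harAction x h ∈ independentSequences N K R := by
  obtain ⟨g, hg, hgx⟩ := hx
  have hg1 : g [] = 1 := (hS hg).1.1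
  have hg0 : ∀ u, depth u = 0 → u ≠ [] → g u = 0 := fun u hu hne =>
    PiTilde_eq_zero_of_depth_eq_zero (hS hg) hu hne
  exact harAction_mem_independentSequences hR hid (adSet_depth_zero hg1 hg0 hgx)
    (adSet_depth_one hg1 hg0 hgx) (sumsIn_adSet hR hg1 hg0 hgx (hSR g hg)) hh

end Inclusions

end HarmonicIhara

open HarmonicIhara
theorem mainTheorem5 (p : ℕ) [Fact p.Prime] (N : ℕ) (hNp : N.Coprime p)
    (K : Type*) [NormedField K] [NormedAlgebra ℚ_[p] K] (hK : ∃ ξ : K, IsPrimitiveRoot ξ N)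
    (A : Type*) [NormedCommRing A] [NormedAlgebra K A] [CompleteSpace A] [IsUltrametricDist A]
    (α : ℕ) (hα : 0 < α) :
    -- (i) linear independence of the multiple harmonic sums
    (harSeq N K A (p ^ α) ∈ independentSequences N K (overconvergentRing A) ∧
      harSeq N K A (p ^ α) ∈ independentSequences N K (analyticRing A)) ∧
    -- (ii) stability under the harmonic Ihara action (which is well-defined)
    ((∀ x ∈ adSet (PiTildeSigmaDagger N K A),
        ∀ h ∈ independentSequences N K (overconvergentRing A),
          (∀ n, adIhara (adScale n x) (h n) ∈ limSpace N K A) ∧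
            harAction x h ∈ independentSequences N K (overconvergentRing A)) ∧
      (∀ x ∈ adSet (PiTildeSigma N K A),
        ∀ h ∈ independentSequences N K (analyticRing A),
          (∀ n, adIhara (adScale n x) (h n) ∈ limSpace N K A) ∧
            harAction x h ∈ independentSequences N K (analyticRing A))) ∧
    -- (iii) the orbit of the multiple harmonic sums
    (harOrbit (adSet (PiTildeSigma N K A)) (harSeq N K A (p ^ α)) ⊆
        independentSequences N K (overconvergentRing A) ∧
      harOrbit (adSet (PiTildeSigma N K A)) (harSeq N K A (p ^ α)) ⊆
        independentSequences N K (analyticRing A)) := by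
  have hN : 0 < N := by
    rcases Nat.eq_zero_or_pos N with rfl | h
    · exact absurd ((Nat.coprime_zero_left p).1 hNp) (Fact.out : p.Prime).one_lt.ne'
    · exact h
  have : NeZero N := ⟨hN.ne'⟩
  have : CharZero K := charZero_of_injective_algebraMap (algebraMap ℚ_[p] K).injective
  -- Needed to divide by k + 1 in the shuffle equation.
  let _ : Algebra ℚ A := Algebra.compHom A (algebraMap ℚ K)
  have hle := overconvergentRing_le_analyticRing (A := A)
  have hi : harSeq N K A (p ^ α) ∈ independentSequences N K (analyticRing A) := by
    refine ⟨harSeq_mem_drrtSpace _, ?_⟩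
    have h := (linearIndependent_har p hN hK A).comp _
      (twist_injective (K := K) (hNp.pow_right α))
    convert h using 3 with w n
    exact harSeq_replicate_append_toWord (A := A) _ n 0 w
  have hii : ∀ x ∈ adSet (PiTildeSigma N K A), ∀ h ∈ independentSequences N K (analyticRing A),
      (∀ n, adIhara (adScale n x) (h n) ∈ limSpace N K A) ∧
        harAction x h ∈ independentSequences N K (analyticRing A) := fun x hx h hh =>
    harAction_mem_of_mem_adSet (R := analyticRing A) (fun a => IsAnalyticOfRadius.const 1 a)
      (id_isAnalyticOfRadius 1) (fun g hg => hg.1)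
      (fun g hg => sumsIn_of_mem_PiTildeSigma hg) hx hh
  -- Here x need not be overconvergent, so the overconvergent inclusion is also obtained through
  -- independence over the larger ring.
  have hiii : harOrbit (adSet (PiTildeSigma N K A)) (harSeq N K A (p ^ α)) ⊆
      independentSequences N K (analyticRing A) := by
    rintro _ ⟨x, hx, rfl⟩
    exact (hii x hx _ hi).2
  refine ⟨⟨independentSequences_anti hle hi, hi⟩, ⟨fun x hx h hh => ?_, hii⟩,
    hiii.trans (independentSequences_anti hle), hiii⟩
  exact harAction_mem_of_mem_adSet (R := overconvergentRing A)
    (fun a => ⟨2, one_lt_two, IsAnalyticOfRadius.const 2 a⟩)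
    ⟨2, one_lt_two, id_isAnalyticOfRadius 2⟩ (fun g hg => hg.1)
    (fun g hg => sumsIn_of_mem_PiTildeSigmaDagger hg) hx hh
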